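/- **ADOPT converges to an optimal attribute order.** *Query.* A join query has a nonempty finite set $A$ of join attributes, finite relations over subsets of $A$, possibly further join predicates over subsets of $A$, and for each attribute a nonempty integer value range. Two attributes *connect* if they occur in a common relation or predicate; the query is assumed connected. The search space consists of the orders of $A$ in which each attribute after the first connects to an earlier one. Cubes are products of integer intervals, written half-open as $[l_i,u_i)$, with $\mathrm{Volume}(c)=\prod_i(u_i-l_i)$. *Execution of an order $o$.* There are $n\ge 1$ threads and a budget of $b\ge 1$ steps per thread and episode. The set $U$ of unprocessed cubes is initially the cube of all value ranges, split evenly (up to rounding) along a widest attribute into $n$ cubes, empty ones being dropped. In an episode, as long as some thread has budget left and unretrieved cubes remain, the thread with most budget left retrieves a uniformly random unretrieved cube $c$ of $U$. It runs the trie join with order $o$ inside $c$: attributes are fixed in the order $o$, each running in increasing order through the values in its range for which every relation containing it has a row agreeing with all values fixed so far, and which satisfy every predicate whose attributes are then all fixed. Each recursive invocation is one step; after each value has been handled, the join stops if its number of steps exceeds the thread's remaining budget. If the join stops with a timeout after completing the value combination $(v_0,\dots,v_k)$ of the first $k+1$ attributes of $o$, the processed cubes are, for $i\le k$, those with the first $i$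 attributes fixed to $v_0,\dots,v_{i-1}$, the next one below $v_i$ (up to and including $v_k$ if $i=k$), and the others unrestricted in $c$; the complementary cubes, with the next attribute above $v_i$, become unprocessed cubes for the following episodes (if nonempty). If there is no timeout, $c$ is processed completely. The reward of an episode is the total volume of the processed cubes divided by the volume of the query. Processing ends when $U=\emptyset$. Let $e_o$ be the expected number of episodes when only $o$ is used. The *average reward per episode* $r_o$ is the expected total reward over these episodes divided by $e_o$. The number of computational steps per episode is taken to be the constant $nb$, so the (expected) *number of processing steps* of $o$ is $n\,b\,e_o$. An order in the search space is *optimal* if it minimizes this number over the search space. *Learning.* ADOPT chooses orders by UCT with an exploration constant $C>0$. States are prefixes of orders, and the search tree initially consists of the root (the empty prefix). In each episode $t=0,1,2,\dots$ it builds a complete order attribute by attribute. At a prefix $p$, if some admissible successors $pa$ have no tree node, it moves to one of them (chosen arbitrarily, e.g. at random). Otherwise it moves to a successor maximizing $\bar X_{pa}+C\sqrt{\ln N_p/N_{pa}}$, where $N$ and $\bar X$ are the number and the mean of the rewards recorded at a node. Then a node is added for the first prefix of the selected order without a node (if any), and the reward is recorded at all nodes on the path, including the new one. Rewards are random as in the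 Markov decision process underlying ADOPT: for each order $o$ of the search space, the rewards of its successive executions are independent, identically distributed, $[0,1]$-valued random variables with expectation $r_o$. The learning process is considered over an unbounded number of episodes. *Claim.* Almost surely, 1. the fraction of the first $T$ episodes in which the selected order is optimal (i.e. minimizes the number of processing steps) tends to $1$ as $T\to\infty$; and 2. for all sufficiently large $T$, every order that is best according to the search tree after $T$ episodes (at each prefix it continues with an admissible successor of maximal mean reward) is optimal. -/

import Mathlib

open MeasureTheory ProbabilityTheory Filter Topology
open scoped ENNReal NNReal

namespace Adopt

variable {A : Type*} [Fintype A] [DecidableEq A]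

/-! ### Queries and cubes -/

/-- An input relation (after unary filters): a finite table over the join attributes in `scope`. -/
structure Rel (A : Type*) where
  scope : Finset A
  rows : Finset (scope → ℤ)

/-- A further (non-equality) join predicate, referring to the attributes in `scope`. -/
structure Pred (A : Type*) where
  scope : Finset A
  holds : (scope → ℤ) → Prop

/-- A join query over the join attributes `A`: it joins `rels` on equal attributes, subject to
`preds`. The values of attribute `a` range over the nonempty integer interval
`lo a ≤ v < hi a`. -/
structure Query (A : Type*) where
  rels : List (Rel A)
  preds : List (Pred A)
  lo : A → ℤ
  hi : A → ℤ
  lo_lt_hi : ∀ a, lo a < hi a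

/-- A cube: the product over all attributes of the integer intervals `lo a ≤ v < hi a`. Bounds are
half-open, so a closed integer range `[l, u]` is written with `hi = u + 1`. -/
@[ext] structure Cube (A : Type*) where
  lo : A → ℤ
  hi : A → ℤ

/-- `Volume(c) = ∏ᵢ (c.uᵢ - c.lᵢ)`; for half-open integer ranges, the number of value vectors. -/
def Cube.volume (c : Cube A) : ℕ := ∏ a, (c.hi a - c.lo a).toNat

/-- Replace the range of attribute `a` by `l ≤ v < h`. -/
def Cube.restrict (c : Cube A) (a : A) (l h : ℤ) : Cube A :=
  ⟨Function.update c.lo a l, Function.update c.hi a h⟩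

/-- The cube spanned by the value ranges of all join attributes of the query. -/
def Query.cube (q : Query A) : Cube A := ⟨q.lo, q.hi⟩

/-! ### Join processing of one cube -/

/-- `v` is produced by the iterator of the trie join for attribute `a`, when exactly the attributes
in `F` are fixed already, to the values `M`: each relation with attribute `a` has a row that agrees
with `M` on its fixed attributes and has value `v` at `a`, and all join predicates that refer to
`a` and otherwise only to fixed attributes are satisfied. -/
def Query.Matches (q : Query A) (F : Finset A) (M : A → ℤ) (a : A) (v : ℤ) : Prop :=
  (∀ R ∈ q.rels, a ∈ R.scope → ∃ row ∈ R.rows, ∀ x : R.scope,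
      (x.1 = a → row x = v) ∧ (x.1 ≠ a → x.1 ∈ F → row x = M x.1)) ∧
  (∀ P ∈ q.preds, a ∈ P.scope → P.scope ⊆ insert a F →
      P.holds (fun x => Function.update M a v x.1))

open Classical in
/-- The matching values for attribute `a` inside the target cube, in increasing order. -/
noncomputable def Query.values (q : Query A) (c : Cube A) (F : Finset A) (M : A → ℤ) (a : A) :
    List ℤ :=
  ((Finset.Ico (c.lo a) (c.hi a)).filter (q.Matches F M a)).sort (· ≤ ·)

/-- The loop over the values of one attribute: handle each value by the recursive call `f`, and
break as soon as the total number of steps exceeds the budget `b`. The state is the number of steps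
made so far. The result is the number of steps and, if the loop was left by a break, the values
last considered for the current and the following attributes, up to the attribute at which the
timeout was noticed (whose last value has then been considered completely). -/
def scan (b : ℕ) (f : ℤ → ℕ → ℕ × Option (List ℤ)) : List ℤ → ℕ → ℕ × Option (List ℤ)
  | [], s => (s, none)
  | v :: vs, s =>
    match f v s with
    | (s', some w) => (s', some (v :: w))
    | (s', none) => if b < s' then (s', some [v]) else scan b f vs s'

/-- The recursive join with timeout (the list is what remains of the attribute order). Every
invocation counts as one computational step. Output tuples are not recorded, since only progress
matters here. -/
noncomputable def joinRec (q : Query A) (b : ℕ) (c : Cube A) :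
    List A → Finset A → (A → ℤ) → ℕ → ℕ × Option (List ℤ)
  | [], _, _, s => (s + 1, none)
  | a :: o, F, M, s =>
    scan b (fun v s' => joinRec q b c o (insert a F) (Function.update M a v) s')
      (q.values c F M a) (s + 1)

/-- Cubes processed by a join over `c` that was stopped at the given values: for each attribute, the
previous attributes are fixed to their last values, the attribute runs over the values below its
last value (including the last value for the final attribute of the list, as this value has been
considered completely), the later ones over their full range. -/
def processed : List A → List ℤ → Cube A → List (Cube A)
  | a :: _, [v], c => [c.restrict a (c.lo a) (v + 1)]
  | a :: o, v :: w :: vs, c =>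
    c.restrict a (c.lo a) v :: processed o (w :: vs) (c.restrict a v (v + 1))
  | _, _, _ => []

/-- The complementary unprocessed cubes: previous attributes are fixed to their last values, the
attribute runs over the values above its last value, the later ones over their full range. -/
def unprocessed : List A → List ℤ → Cube A → List (Cube A)
  | a :: o, v :: vs, c =>
    c.restrict a (v + 1) (c.hi a) :: unprocessed o vs (c.restrict a v (v + 1))
  | _, _, _ => []

/-- The outcome of processing one target cube. -/
structure Outcome (A : Type*) where
  /-- the processed cubes -/
  done : List (Cube A)
  /-- the nonempty remaining cubes -/
  left : List (Cube A)
  /-- the number of computational steps -/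
  steps : ℕ

/-- Process the target cube `c` with attribute order `o` under the remaining budget `b`. -/
noncomputable def joinOneCube (q : Query A) (b : ℕ) (o : List A) (c : Cube A) : Outcome A :=
  match joinRec q b c o ∅ (fun _ => 0) 0 with
  | (s, none) => ⟨[c], [], s⟩
  | (s, some vs) => ⟨processed o vs c, (unprocessed o vs c).filter (fun u => 0 < u.volume), s⟩

/-! ### Task manager, episodes, rewards -/

/-- An attribute with the largest value range. -/
noncomputable def Query.widest [Nonempty A] (q : Query A) : A :=
  Classical.choose (Finset.exists_max_image Finset.univ (fun a => q.hi a - q.lo a)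
    Finset.univ_nonempty)

/-- The initial unprocessed cubes: the range of the widest attribute is divided (up to rounding)
equally among the `n` threads; empty shares are dropped. -/
noncomputable def Query.initCubes [Nonempty A] (q : Query A) (n : ℕ) : Multiset (Cube A) :=
  let a := q.widest
  let cut : ℕ → ℤ := fun i => q.lo a + (i * (q.hi a - q.lo a)) / n
  ((Multiset.range n).map (fun i => q.cube.restrict a (cut i) (cut (i + 1)))).filter
    (fun c => 0 < c.volume)

/-- `Reward(P, q)`: the volume of the processed cubes, scaled to the volume of the query. -/
noncomputable def reward (q : Query A) (P : List (Cube A)) : ℝ≥0 :=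
  ((P.map Cube.volume).sum : ℝ≥0) / q.cube.volume

open Classical in
/-- The parallel loop of one episode. `pool` holds the unprocessed cubes not yet retrieved, `budgets`
the remaining budgets of the threads, `left` the unprocessed parts of the target cubes on which a
thread ran out of budget (available again after the episode), `r` the accumulated reward. Steps take
unit time on each thread, so the next thread to become free is the one with the largest remaining
budget; it retrieves a uniformly random cube. The first argument bounds the number of retrievals. -/
noncomputable def episodeLoop (q : Query A) (o : List A) :
    ℕ → Multiset (Cube A) → Multiset (Cube A) → Multiset ℕ → ℝ≥0 → PMF (Multiset (Cube A) × ℝ≥0)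
  | 0, pool, left, _, r => PMF.pure (pool + left, r)
  | k + 1, pool, left, budgets, r =>
    if h : pool ≠ 0 ∧ 0 < budgets.sup then
      (PMF.ofMultiset pool h.1).bind fun c =>
        let out := joinOneCube q budgets.sup o c
        episodeLoop q o k (pool.erase c) (left + (out.left : Multiset (Cube A)))
          ((budgets.sup - out.steps) ::ₘ budgets.erase budgets.sup) (r + reward q out.done)
    else PMF.pure (pool + left, r)

/-- One episode: execute order `o` with `n` threads and a budget of `b` steps per thread, starting
from the unprocessed cubes `U`. The result is the joint law of the new set of unprocessed cubes and
the episode's reward. Each retrieval takes one cube, so `U.card` bounds their number. -/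
noncomputable def episode (q : Query A) (n b : ℕ) (o : List A) (U : Multiset (Cube A)) :
    PMF (Multiset (Cube A) × ℝ≥0) :=
  episodeLoop q o U.card U 0 (Multiset.replicate n b) 0

/-- The law of the set of unprocessed cubes after `k` episodes that all use order `o`. -/
noncomputable def remaining [Nonempty A] (q : Query A) (n b : ℕ) (o : List A) :
    ℕ → PMF (Multiset (Cube A))
  | 0 => PMF.pure (q.initCubes n)
  | k + 1 => (remaining q n b o k).bind fun U => (episode q n b o U).map Prod.fst

/-- The expected number of episodes that processing the query with order `o` takes, i.e. of episodes
that start with a nonempty set of unprocessed cubes. -/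
noncomputable def expectedEpisodes [Nonempty A] (q : Query A) (n b : ℕ) (o : List A) : ℝ≥0∞ :=
  ∑' k, (remaining q n b o k).toOuterMeasure {U | U ≠ 0}

/-- The expected reward accumulated over all these episodes. -/
noncomputable def expectedReward [Nonempty A] (q : Query A) (n b : ℕ) (o : List A) : ℝ≥0∞ :=
  ∑' k, ∑' U, remaining q n b o k U * ∑' x, episode q n b o U x * (x.2 : ℝ≥0∞)

/-- The average reward per episode of order `o`. -/
noncomputable def averageReward [Nonempty A] (q : Query A) (n b : ℕ) (o : List A) : ℝ :=
  (expectedReward q n b o / expectedEpisodes q n b o).toReal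

/-- The expected number of computational steps for processing the query with order `o`. Each episode
takes the same number `n * b` of steps: `b` for each thread. -/
noncomputable def expectedSteps [Nonempty A] (q : Query A) (n b : ℕ) (o : List A) : ℝ≥0∞ :=
  (n * b : ℝ≥0∞) * expectedEpisodes q n b o

/-! ### The search space of attribute orders -/

/-- Two attributes connect if they occur in a common relation or join predicate. -/
def Query.Connects (q : Query A) (a a' : A) : Prop :=
  (∃ R ∈ q.rels, a ∈ R.scope ∧ a' ∈ R.scope) ∨ (∃ P ∈ q.preds, a ∈ P.scope ∧ a' ∈ P.scope)

/-- `a` may be appended to the prefix `p`: it is not in `p` and, unless `p` is empty, connects to an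
attribute of `p`. -/
def Query.Action (q : Query A) (p : List A) (a : A) : Prop :=
  a ∉ p ∧ (p = [] ∨ ∃ a' ∈ p, q.Connects a a')

/-- The complete attribute orders in the search space. -/
def Query.IsOrder (q : Query A) (o : List A) : Prop :=
  (∀ a, a ∈ o) ∧ ∀ p a, p ++ [a] <+: o → q.Action p a

/-- `o` is an optimal attribute order: it minimizes the number of computational steps. -/
def IsOptimal [Nonempty A] (q : Query A) (n b : ℕ) (o : List A) : Prop :=
  q.IsOrder o ∧ ∀ o', q.IsOrder o' → expectedSteps q n b o ≤ expectedSteps q n b o'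

/-! ### UCT -/

/-- Reward statistics of the search tree: for each prefix, the number of episodes and the sum of the
rewards recorded at its node. A non-root prefix has a node iff its count is positive. -/
structure Stats (A : Type*) where
  count : List A → ℕ
  total : List A → ℝ

/-- The mean reward recorded at a node. -/
noncomputable def Stats.mean (S : Stats A) (p : List A) : ℝ := S.total p / S.count p

/-- The upper confidence bound of the child `p ++ [a]`, with exploration constant `C`. -/
noncomputable def Stats.ucb (S : Stats A) (C : ℝ) (p : List A) (a : A) : ℝ :=
  S.mean (p ++ [a]) + C * Real.sqrt (Real.log (S.count p) / S.count (p ++ [a]))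

open Classical in
/-- Update after selecting order `o` with reward `r`: the reward is recorded at all nodes on the path,
and at a new node for the first prefix of `o` that has no node (i.e. at those prefixes whose parent
is the root or already has a node). -/
noncomputable def Stats.update (S : Stats A) (o : List A) (r : ℝ) : Stats A where
  count p := if p <+: o ∧ (p.dropLast = [] ∨ 0 < S.count p.dropLast) then S.count p + 1
    else S.count p
  total p := if p <+: o ∧ (p.dropLast = [] ∨ 0 < S.count p.dropLast) then S.total p + r
    else S.total p

/-- The UCT rule at prefix `p`: if some successors have no node, go to one of those (any of them);
otherwise go to a successor with maximal upper confidence bound. -/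
def UCTStep (q : Query A) (C : ℝ) (S : Stats A) (p : List A) (a : A) : Prop :=
  q.Action p a ∧
    ((∃ a', q.Action p a' ∧ S.count (p ++ [a']) = 0) → S.count (p ++ [a]) = 0) ∧
    ((∀ a', q.Action p a' → S.count (p ++ [a']) ≠ 0) →
      ∀ a', q.Action p a' → S.ucb C p a' ≤ S.ucb C p a)

/-- The complete order `o` can be selected by UCT under the statistics `S`. -/
def UCTSelects (q : Query A) (C : ℝ) (S : Stats A) (o : List A) : Prop :=
  q.IsOrder o ∧ ∀ p a, p ++ [a] <+: o → UCTStep q C S p a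

open Classical in
/-- The reward of episode `t`, if `sel` are the selected orders and `X o k` is the reward of the
`k`-th execution (counted from zero) of order `o`. -/
noncomputable def episodeReward (X : List A → ℕ → ℝ) (sel : ℕ → List A) (t : ℕ) : ℝ :=
  X (sel t) ((Finset.range t).filter (fun s => sel s = sel t)).card

/-- The statistics before episode `t`. -/
noncomputable def stats (X : List A → ℕ → ℝ) (sel : ℕ → List A) : ℕ → Stats A
  | 0 => ⟨fun _ => 0, fun _ => 0⟩
  | t + 1 => (stats X sel t).update (sel t) (episodeReward X sel t)

/-- `sel` is a sequence of orders selected by ADOPT in the episodes `0, 1, 2, …`. -/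
def IsRun (q : Query A) (C : ℝ) (X : List A → ℕ → ℝ) (sel : ℕ → List A) : Prop :=
  ∀ t, UCTSelects q C (stats X sel t) (sel t)

/-- `o` is the order currently estimated to be best: at each prefix it continues with a successor of
maximal mean reward. -/
def IsGreedy (q : Query A) (S : Stats A) (o : List A) : Prop :=
  q.IsOrder o ∧ ∀ p a, p ++ [a] <+: o →
    ∀ a', q.Action p a' → S.mean (p ++ [a']) ≤ S.mean (p ++ [a])

end Adopt

set_option linter.unusedSectionVars false

/-! Processing a cube splits its volume exactly into a processed and a remaining part, and the
processed part is never empty. So the unprocessed volume, a natural number, drops in every episode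
until nothing is left, and the rewards of a complete execution add up to exactly 1. Therefore the
average reward of an order is the inverse of its expected number of episodes (`averageReward_eq`),
and fewest steps means largest average reward (`isOptimal_iff`).

It remains to show that UCT finds the orders of largest mean reward. By the strong law, almost
surely the sample means of every order converge; for such an outcome the rest is deterministic. At a
single node (`UCBProcess`), every child is visited infinitely often, since the bonus of a neglected
child grows without bound (`tendsto_count`). If the means of the children converge, a child with a
smaller limit receives only `O(log N)` of the `N` visits (`count_ratio_tendsto_zero`), so the mean
at the parent, a weighted average up to a vanishing term, tends to the largest limit
(`mean_tendsto`).

In the tree, counts tend to infinity by induction down from the root, and means tend to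
`Query.value` by induction up from the complete orders. The path to a suboptimal order loses value
at some prefix, which forces frequency 0 on that order; as there are finitely many orders, the
optimal ones have frequency 1. Likewise finitely many comparisons of means are eventually all
correct, so greedy descent never loses value. -/

namespace Adopt

section Volume

variable {A : Type*} [Fintype A] [DecidableEq A]

/-! ### Volumes -/

/-- The total volume of a multiset of cubes. -/
def totalVolume (U : Multiset (Cube A)) : ℕ := (U.map Cube.volume).sum

@[simp] lemma totalVolume_zero : totalVolume (0 : Multiset (Cube A)) = 0 := rfl

lemma totalVolume_add (U W : Multiset (Cube A)) :
    totalVolume (U + W) = totalVolume U + totalVolume W := by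
  simp [totalVolume]

@[simp] lemma totalVolume_cons (c : Cube A) (U : Multiset (Cube A)) :
    totalVolume (c ::ₘ U) = c.volume + totalVolume U := by
  simp [totalVolume]

lemma totalVolume_filter_pos (U : Multiset (Cube A)) :
    totalVolume (U.filter (fun c => 0 < c.volume)) = totalVolume U := by
  induction U using Multiset.induction_on with
  | empty => simp
  | cons c U ih =>
    by_cases h : 0 < c.volume
    · simp [h, ih]
    · rw [Multiset.filter_cons_of_neg (p := fun c : Cube A => 0 < c.volume) _ h, ih,
        totalVolume_cons]
      omega

lemma totalVolume_coe (l : List (Cube A)) :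
    totalVolume (l : Multiset (Cube A)) = (l.map Cube.volume).sum := by
  simp [totalVolume]

lemma eq_zero_of_totalVolume_eq_zero {U : Multiset (Cube A)} (hU : ∀ c ∈ U, 0 < c.volume)
    (h : totalVolume U = 0) : U = 0 := by
  induction U using Multiset.induction_on with
  | empty => rfl
  | cons c U ih =>
    have := hU c (Multiset.mem_cons_self c U)
    rw [totalVolume_cons] at h
    omega

lemma Cube.volume_restrict (c : Cube A) (a : A) (l h : ℤ) :
    (c.restrict a l h).volume =
      (h - l).toNat * ∏ x ∈ Finset.univ.erase a, (c.hi x - c.lo x).toNat := by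
  rw [Cube.volume, ← Finset.mul_prod_erase _ _ (Finset.mem_univ a)]
  congr 1
  · simp [Cube.restrict]
  · refine Finset.prod_congr rfl fun x hx => ?_
    simp [Cube.restrict, Finset.ne_of_mem_erase hx]

lemma Cube.volume_eq_mul (c : Cube A) (a : A) :
    c.volume = (c.hi a - c.lo a).toNat *
      ∏ x ∈ Finset.univ.erase a, (c.hi x - c.lo x).toNat := by
  rw [Cube.volume, ← Finset.mul_prod_erase _ _ (Finset.mem_univ a)]

lemma Cube.volume_restrict_add (c : Cube A) (a : A) {v : ℤ} (h₁ : c.lo a ≤ v) (h₂ : v ≤ c.hi a) :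
    (c.restrict a (c.lo a) v).volume + (c.restrict a v (c.hi a)).volume = c.volume := by
  rw [c.volume_eq_mul a, volume_restrict, volume_restrict, ← add_mul]
  congr 1
  omega

lemma Cube.volume_restrict_add_three (c : Cube A) (a : A) {v : ℤ} (h₁ : c.lo a ≤ v)
    (h₂ : v < c.hi a) :
    (c.restrict a (c.lo a) v).volume + (c.restrict a v (v + 1)).volume +
      (c.restrict a (v + 1) (c.hi a)).volume = c.volume := by
  rw [c.volume_eq_mul a, volume_restrict, volume_restrict, volume_restrict, ← add_mul, ← add_mul]
  congr 1
  omega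

lemma Cube.volume_restrict_pos {c : Cube A} (hc : 0 < c.volume) (a : A) {l h : ℤ} (hlh : l < h) :
    0 < (c.restrict a l h).volume := by
  rw [c.volume_eq_mul a] at hc
  rw [volume_restrict]
  exact Nat.mul_pos (by omega) (Nat.pos_of_mul_pos_left hc)

lemma Query.volume_cube_pos (q : Query A) : 0 < q.cube.volume := by
  refine Finset.prod_pos fun a _ => ?_
  have := q.lo_lt_hi a
  simp only [Query.cube]
  omega

lemma sum_range_toNat_sub {f : ℕ → ℤ} (hf : Monotone f) (n : ℕ) :
    ∑ i ∈ Finset.range n, (f (i + 1) - f i).toNat = (f n - f 0).toNat := by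
  induction n with
  | zero => simp
  | succ n ih =>
    have h₁ := hf (Nat.zero_le n)
    have h₂ := hf (Nat.le_succ n)
    rw [Finset.sum_range_succ, ih]
    simp only [Nat.succ_eq_add_one] at h₂
    omega

/-- The rounded cut points are monotone and run exactly from the lower to the upper bound, so the
widths telescope; dropped cubes have volume 0. -/
lemma totalVolume_initCubes [Nonempty A] (q : Query A) {n : ℕ} (hn : 1 ≤ n) :
    totalVolume (q.initCubes n) = q.cube.volume := by
  have hn' : (0 : ℤ) < n := by exact_mod_cast hn
  have hlt := q.lo_lt_hi q.widest
  let f : ℕ → ℤ := fun i => q.lo q.widest + (i * (q.hi q.widest - q.lo q.widest)) / n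
  have hf : Monotone f := by
    intro i j hij
    refine add_le_add le_rfl (Int.ediv_le_ediv hn' ?_)
    exact mul_le_mul_of_nonneg_right (by exact_mod_cast hij) (by omega)
  have h0 : f 0 = q.lo q.widest := by simp [f]
  have h1 : f n = q.hi q.widest := by
    simp only [f]
    rw [Int.mul_ediv_cancel_left _ hn'.ne']
    ring
  have key := sum_range_toNat_sub hf n
  rw [h0, h1] at key
  rw [Query.initCubes, totalVolume_filter_pos, totalVolume, Multiset.map_map,
    q.cube.volume_eq_mul q.widest]
  simp only [Function.comp_def, Cube.volume_restrict]
  change ∑ i ∈ Finset.range n, _ = _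
  rw [← Finset.sum_mul]
  congr 1

lemma volume_pos_of_mem_initCubes [Nonempty A] {q : Query A} {n : ℕ} {c : Cube A}
    (hc : c ∈ q.initCubes n) : 0 < c.volume := by
  rw [Query.initCubes, Multiset.mem_filter] at hc
  exact hc.2

/-! ### Volumes processed by one join -/

/-- The values at which a join over `c` with order `o` can be stopped. -/
def StopsIn (c : Cube A) : List A → List ℤ → Prop
  | a :: _, [v] => v ∈ Set.Ico (c.lo a) (c.hi a)
  | a :: o, v :: w :: vs => v ∈ Set.Ico (c.lo a) (c.hi a) ∧ StopsIn c o (w :: vs)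
  | _, _ => False

/-- The join recurses with the whole cube `c`, whereas `processed` and `unprocessed` recurse with
restricted cubes. The two differ only at attributes already fixed, which do not occur in the rest of
the order. -/
lemma StopsIn.congr {c c' : Cube A} {o : List A} {vs : List ℤ} (h : StopsIn c o vs)
    (hcc : ∀ a ∈ o, c.lo a = c'.lo a ∧ c.hi a = c'.hi a) : StopsIn c' o vs := by
  induction o generalizing vs with
  | nil => simp [StopsIn] at h
  | cons a o ih =>
    have ha := hcc a (by simp)
    match vs, h with
    | [v], h =>
      simp only [StopsIn] at h ⊢
      rwa [← ha.1, ← ha.2]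
    | v :: w :: vs, h =>
      simp only [StopsIn] at h ⊢
      rw [← ha.1, ← ha.2]
      exact ⟨h.1, ih h.2 fun a' ha' => hcc a' (by simp [ha'])⟩

/-- A break is either noticed at this level, after `v` is complete, or passed up from the recursive
call for `v`. -/
lemma scan_eq_some {b : ℕ} {f : ℤ → ℕ → ℕ × Option (List ℤ)} {l : List ℤ} {s s' : ℕ}
    {vs : List ℤ} (h : scan b f l s = (s', some vs)) :
    ∃ v ∈ l, vs = [v] ∨ ∃ s₁ s₂ w, f v s₁ = (s₂, some w) ∧ vs = v :: w := by
  induction l generalizing s with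
  | nil => simp [scan] at h
  | cons v l ih =>
    rw [scan] at h
    split at h
    · next s₂ w hw =>
      simp only [Prod.mk.injEq, Option.some.injEq] at h
      exact ⟨v, by simp, Or.inr ⟨s, s₂, w, hw, h.2.symm⟩⟩
    · split at h
      · simp only [Prod.mk.injEq, Option.some.injEq] at h
        exact ⟨v, by simp, Or.inl h.2.symm⟩
      · obtain ⟨u, hu, h⟩ := ih h
        exact ⟨u, by simp [hu], h⟩

lemma stopsIn_of_joinRec {q : Query A} {b : ℕ} {c : Cube A} {o : List A} {F : Finset A}
    {M : A → ℤ} {s s' : ℕ} {vs : List ℤ} (h : joinRec q b c o F M s = (s', some vs)) :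
    StopsIn c o vs := by
  induction o generalizing F M s s' vs with
  | nil => simp [joinRec] at h
  | cons a o ih =>
    rw [joinRec] at h
    obtain ⟨v, hv, h⟩ := scan_eq_some h
    have hv' : v ∈ Set.Ico (c.lo a) (c.hi a) := by
      simp only [Query.values, Finset.mem_sort, Finset.mem_filter, Finset.mem_Ico] at hv
      exact hv.1
    rcases h with rfl | ⟨s₁, s₂, w, hw, rfl⟩
    · exact hv'
    · have := ih hw
      match w, this with
      | [], h => cases o <;> simp [StopsIn] at h
      | u :: us, h => exact ⟨hv', h⟩

/-- Each level cuts the cube into slabs below, at and above the last value. The middle slab is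
divided further at the next level; at the last level it belongs to the processed part. -/
lemma volume_processed_add_unprocessed {c : Cube A} {o : List A} {vs : List ℤ} (ho : o.Nodup)
    (h : StopsIn c o vs) :
    ((processed o vs c).map Cube.volume).sum + ((unprocessed o vs c).map Cube.volume).sum =
      c.volume := by
  induction o generalizing vs c with
  | nil => simp [StopsIn] at h
  | cons a o ih =>
    rw [List.nodup_cons] at ho
    match vs, h with
    | [v], h =>
      simp only [StopsIn, Set.mem_Ico] at h
      have := c.volume_restrict_add a (v := v + 1) (by omega) (by omega)
      cases o <;> simpa [processed, unprocessed] using this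
    | v :: w :: vs, h =>
      simp only [StopsIn, Set.mem_Ico] at h
      have h' : StopsIn (c.restrict a v (v + 1)) o (w :: vs) := by
        refine h.2.congr fun a' ha' => ?_
        have : a' ≠ a := fun e => ho.1 (e ▸ ha')
        simp [Cube.restrict, this]
      have e₁ := ih ho.2 h'
      have e₂ := c.volume_restrict_add_three a h.1.1 h.1.2
      simp only [processed, unprocessed, List.map_cons, List.sum_cons]
      omega

/-- A timeout is noticed only after some value is complete, so the last processed slab contains that
value. This is what guarantees progress however small the budget is. -/
lemma volume_processed_pos {c : Cube A} {o : List A} {vs : List ℤ} (ho : o.Nodup)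
    (h : StopsIn c o vs) (hc : 0 < c.volume) :
    0 < ((processed o vs c).map Cube.volume).sum := by
  induction o generalizing vs c with
  | nil => simp [StopsIn] at h
  | cons a o ih =>
    rw [List.nodup_cons] at ho
    match vs, h with
    | [v], h =>
      simp only [StopsIn, Set.mem_Ico] at h
      have := Cube.volume_restrict_pos hc a (l := c.lo a) (h := v + 1) (by omega)
      simpa [processed] using this
    | v :: w :: vs, h =>
      simp only [StopsIn, Set.mem_Ico] at h
      have h' : StopsIn (c.restrict a v (v + 1)) o (w :: vs) := by
        refine h.2.congr fun a' ha' => ?_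
        have : a' ≠ a := fun e => ho.1 (e ▸ ha')
        simp [Cube.restrict, this]
      have := ih ho.2 h' (Cube.volume_restrict_pos hc a (by omega))
      simp only [processed, List.map_cons, List.sum_cons]
      omega

lemma joinOneCube_volume (q : Query A) (b : ℕ) {o : List A} (ho : o.Nodup) {c : Cube A}
    (hc : 0 < c.volume) :
    ((joinOneCube q b o c).done.map Cube.volume).sum +
        totalVolume ((joinOneCube q b o c).left : Multiset (Cube A)) = c.volume ∧
      0 < ((joinOneCube q b o c).done.map Cube.volume).sum ∧
      ∀ u ∈ (joinOneCube q b o c).left, 0 < u.volume := by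
  rw [joinOneCube]
  split
  · simpa using hc
  · next s vs h =>
    have h := stopsIn_of_joinRec h
    refine ⟨?_, volume_processed_pos ho h hc, fun u hu => by simpa using (List.mem_filter.1 hu).2⟩
    rw [← Multiset.filter_coe, totalVolume_filter_pos, totalVolume_coe]
    exact volume_processed_add_unprocessed ho h

end Volume

/-! ### Expectations under a probability mass function -/

section Expect

variable {α β : Type*}

/-- The expectation of `g` under `p`. -/
noncomputable def expect (p : PMF α) (g : α → ℝ≥0∞) : ℝ≥0∞ := ∑' x, p x * g x

lemma expect_pure (a : α) (g : α → ℝ≥0∞) : expect (PMF.pure a) g = g a := by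
  classical
  rw [expect, tsum_eq_single a]
  · simp
  · intro b hb
    simp [hb]

lemma expect_bind (p : PMF α) (f : α → PMF β) (g : β → ℝ≥0∞) :
    expect (p.bind f) g = expect p fun a => expect (f a) g := by
  simp only [expect, PMF.bind_apply, ← ENNReal.tsum_mul_left, ← ENNReal.tsum_mul_right]
  rw [ENNReal.tsum_comm]
  simp only [mul_assoc]

lemma expect_map (p : PMF α) (f : α → β) (g : β → ℝ≥0∞) :
    expect (p.map f) g = expect p (g ∘ f) := by
  rw [PMF.map, expect_bind]
  simp only [Function.comp_apply, expect_pure]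
  rfl

lemma expect_congr {p : PMF α} {g g' : α → ℝ≥0∞} (h : ∀ x ∈ p.support, g x = g' x) :
    expect p g = expect p g' := by
  refine tsum_congr fun x => ?_
  by_cases hx : x ∈ p.support
  · rw [h x hx]
  · rw [PMF.mem_support_iff, not_not] at hx
    simp [hx]

lemma expect_const (p : PMF α) (r : ℝ≥0∞) : expect p (fun _ => r) = r := by
  rw [expect, ENNReal.tsum_mul_right, p.tsum_coe, one_mul]

lemma expect_add (p : PMF α) (g g' : α → ℝ≥0∞) :
    expect p (fun x => g x + g' x) = expect p g + expect p g' := by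
  simp only [expect, mul_add, ENNReal.tsum_add]

lemma expect_mul_const (p : PMF α) (g : α → ℝ≥0∞) (r : ℝ≥0∞) :
    expect p (fun x => g x * r) = expect p g * r := by
  simp only [expect, ← mul_assoc, ENNReal.tsum_mul_right]

end Expect

/-! ### Rewards of episodes -/

section Episodes

variable {A : Type*} [Fintype A] [DecidableEq A]

lemma reward_mul_volume (q : Query A) (P : List (Cube A)) :
    reward q P * q.cube.volume = ((P.map Cube.volume).sum : ℕ) := by
  have := q.volume_cube_pos
  rw [reward, div_mul_cancel₀]
  · exact_mod_cast this.ne'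

lemma reward_pos (q : Query A) {P : List (Cube A)} (hP : 0 < (P.map Cube.volume).sum) :
    0 < reward q P :=
  div_pos (by exact_mod_cast hP) (by exact_mod_cast q.volume_cube_pos)

-- Loop invariant: pool volume plus left volume plus scaled reward is conserved. The last clause
-- records that a single retrieval already yields positive reward.
open Classical in
lemma episodeLoop_spec (q : Query A) {o : List A} (ho : o.Nodup) (k : ℕ)
    {pool left : Multiset (Cube A)} {budgets : Multiset ℕ} {r : ℝ≥0}
    (hpool : ∀ c ∈ pool, 0 < c.volume) (hleft : ∀ c ∈ left, 0 < c.volume)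
    {x : Multiset (Cube A) × ℝ≥0} (hx : x ∈ (episodeLoop q o k pool left budgets r).support) :
    (totalVolume x.1 : ℝ≥0) + x.2 * q.cube.volume =
        totalVolume pool + totalVolume left + r * q.cube.volume ∧
      (∀ c ∈ x.1, 0 < c.volume) ∧ r ≤ x.2 ∧
      (0 < k → pool ≠ 0 → 0 < budgets.sup → r < x.2) := by
  induction k generalizing pool left budgets r with
  | zero =>
    rw [episodeLoop, PMF.support_pure, Set.mem_singleton_iff] at hx
    subst hx
    refine ⟨by simp [totalVolume_add], fun c hc => ?_, le_rfl, by simp⟩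
    rcases Multiset.mem_add.1 hc with hc | hc
    exacts [hpool c hc, hleft c hc]
  | succ k ih =>
    rw [episodeLoop] at hx
    split at hx
    · next h =>
      rw [PMF.mem_support_bind_iff] at hx
      obtain ⟨c, hc, hx⟩ := hx
      rw [PMF.mem_support_ofMultiset_iff, Multiset.mem_toFinset] at hc
      obtain ⟨h₁, h₂, h₃⟩ := joinOneCube_volume q budgets.sup ho (hpool c hc)
      obtain ⟨i₁, i₂, i₃, -⟩ := ih (fun u hu => hpool u (Multiset.mem_of_mem_erase hu))
        (fun u hu => (Multiset.mem_add.1 hu).elim (hleft u) fun hu => h₃ u (by simpa using hu)) hx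
      have h₄ := reward_pos q h₂
      refine ⟨?_, i₂, le_trans (by simp) i₃, fun _ _ _ => lt_of_lt_of_le (by simpa using h₄) i₃⟩
      rw [i₁, add_mul, reward_mul_volume, totalVolume_add]
      have e : totalVolume pool = c.volume + totalVolume (pool.erase c) := by
        rw [← totalVolume_cons, Multiset.cons_erase hc]
      rw [e, ← h₁]
      push_cast
      ring
    · next h =>
      rw [PMF.support_pure, Set.mem_singleton_iff] at hx
      subst hx
      refine ⟨by simp [totalVolume_add], fun c hc => ?_, le_rfl, fun _ h₁ h₂ => (h ⟨h₁, h₂⟩).elim⟩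
      rcases Multiset.mem_add.1 hc with hc | hc
      exacts [hpool c hc, hleft c hc]

lemma episode_spec (q : Query A) {n b : ℕ} (hn : 1 ≤ n) (hb : 1 ≤ b) {o : List A} (ho : o.Nodup)
    {U : Multiset (Cube A)} (hU : ∀ c ∈ U, 0 < c.volume)
    {x : Multiset (Cube A) × ℝ≥0} (hx : x ∈ (episode q n b o U).support) :
    (totalVolume x.1 : ℝ≥0) + x.2 * q.cube.volume = totalVolume U ∧
      (∀ c ∈ x.1, 0 < c.volume) ∧ (U ≠ 0 → totalVolume x.1 < totalVolume U) := by
  obtain ⟨h₁, h₂, -, h₄⟩ := episodeLoop_spec q ho _ hU (by simp) hx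
  simp only [totalVolume_zero, Nat.cast_zero, zero_mul, add_zero] at h₁
  refine ⟨h₁, h₂, fun hU0 => ?_⟩
  have hsup : 0 < (Multiset.replicate n b).sup :=
    lt_of_lt_of_le hb (Multiset.le_sup (Multiset.mem_replicate.2 ⟨by omega, rfl⟩))
  have hpos := h₄ (Multiset.card_pos.2 hU0) hU0 hsup
  have : (0 : ℝ≥0) < x.2 * q.cube.volume :=
    mul_pos hpos (by exact_mod_cast q.volume_cube_pos)
  have h₅ : (totalVolume x.1 : ℝ≥0) < totalVolume U := by
    rw [← h₁]
    exact lt_add_of_pos_right _ this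
  exact_mod_cast h₅

/-! ### Iterated episodes: termination and total expected reward -/

variable [Nonempty A]

/-- Each episode with work left removes at least one unit of an integer volume. Hence all series
over episodes are finite sums. -/
lemma remaining_spec (q : Query A) {n b : ℕ} (hn : 1 ≤ n) (hb : 1 ≤ b) {o : List A} (ho : o.Nodup)
    (k : ℕ) {U : Multiset (Cube A)} (hU : U ∈ (remaining q n b o k).support) :
    (∀ c ∈ U, 0 < c.volume) ∧ (U = 0 ∨ totalVolume U + k ≤ q.cube.volume) := by
  induction k generalizing U with
  | zero =>
    rw [remaining, PMF.support_pure, Set.mem_singleton_iff] at hU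
    subst hU
    exact ⟨fun c hc => volume_pos_of_mem_initCubes hc, Or.inr (totalVolume_initCubes q hn).le⟩
  | succ k ih =>
    rw [remaining, PMF.mem_support_bind_iff] at hU
    obtain ⟨W, hW, hU⟩ := hU
    rw [PMF.mem_support_map_iff] at hU
    obtain ⟨x, hx, rfl⟩ := hU
    obtain ⟨i₁, i₂⟩ := ih hW
    obtain ⟨h₁, h₂, h₃⟩ := episode_spec q hn hb ho i₁ hx
    refine ⟨h₂, ?_⟩
    by_cases hW0 : W = 0
    · subst hW0
      left
      refine eq_zero_of_totalVolume_eq_zero h₂ ?_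
      rw [totalVolume_zero, Nat.cast_zero, add_eq_zero] at h₁
      exact_mod_cast h₁.1
    · right
      have := h₃ hW0
      have := i₂.resolve_left hW0
      omega

/-- The expected unprocessed volume after `k` episodes. -/
noncomputable def expectedVolume (q : Query A) (n b : ℕ) (o : List A) (k : ℕ) : ℝ≥0∞ :=
  expect (remaining q n b o k) fun U => totalVolume U

/-- The expected reward of episode `k`. -/
noncomputable def episodeExpectedReward (q : Query A) (n b : ℕ) (o : List A) (k : ℕ) : ℝ≥0∞ :=
  expect (remaining q n b o k) fun U => expect (episode q n b o U) fun x => (x.2 : ℝ≥0∞)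

lemma expectedReward_eq (q : Query A) (n b : ℕ) (o : List A) :
    expectedReward q n b o = ∑' k, episodeExpectedReward q n b o k := rfl

variable {q : Query A} {n b : ℕ} (hn : 1 ≤ n) (hb : 1 ≤ b) {o : List A} (ho : o.Nodup)

include hn hb ho

/-- Conservation of volume in expectation, in additive form since subtraction in `ℝ≥0∞` truncates.
-/
lemma expectedVolume_succ (k : ℕ) :
    expectedVolume q n b o (k + 1) + episodeExpectedReward q n b o k * q.cube.volume =
      expectedVolume q n b o k := by
  rw [expectedVolume, remaining, expect_bind, episodeExpectedReward, ← expect_mul_const,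
    ← expect_add, expectedVolume]
  refine expect_congr fun U hU => ?_
  rw [expect_map, ← expect_mul_const, ← expect_add, ← expect_const (episode q n b o U) (totalVolume U)]
  refine expect_congr fun x hx => ?_
  have := (episode_spec q hn hb ho (remaining_spec q hn hb ho k hU).1 hx).1
  rw [Function.comp_apply]
  exact_mod_cast congrArg (fun y : ℝ≥0 => (y : ℝ≥0∞)) this

lemma expectedVolume_zero : expectedVolume q n b o 0 = q.cube.volume := by
  rw [expectedVolume, remaining, expect_pure, totalVolume_initCubes q hn]

lemma remaining_eq_zero {k : ℕ} (hk : q.cube.volume < k) {U : Multiset (Cube A)}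
    (hU : U ∈ (remaining q n b o k).support) : U = 0 :=
  (remaining_spec q hn hb ho k hU).2.resolve_right (by omega)

lemma expectedVolume_eq_zero {k : ℕ} (hk : q.cube.volume < k) :
    expectedVolume q n b o k = 0 := by
  rw [expectedVolume, ← expect_const (remaining q n b o k) 0]
  refine expect_congr fun U hU => ?_
  simp [remaining_eq_zero hn hb ho hk hU]

/-- The conservation law telescopes from the full volume to 0; then the volume, which is finite and
nonzero, cancels. -/
lemma expectedReward_eq_one : expectedReward q n b o = 1 := by
  have hV : (q.cube.volume : ℝ≥0∞) ≠ 0 := by exact_mod_cast q.volume_cube_pos.ne'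
  have hV' : (q.cube.volume : ℝ≥0∞) ≠ ⊤ := ENNReal.natCast_ne_top _
  have hsum (K : ℕ) : expectedVolume q n b o K +
      (∑ k ∈ Finset.range K, episodeExpectedReward q n b o k) * q.cube.volume =
        q.cube.volume := by
    induction K with
    | zero => simp [expectedVolume_zero hn hb ho]
    | succ K ih =>
      rw [Finset.sum_range_succ, add_mul, add_comm (_ * _) (_ * _), ← add_assoc,
        expectedVolume_succ hn hb ho, ih]
  have hzero : ∀ k ∉ Finset.range (q.cube.volume + 1), episodeExpectedReward q n b o k = 0 := by
    intro k hk
    rw [Finset.mem_range, not_lt] at hk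
    have := expectedVolume_succ (q := q) hn hb ho k
    rw [expectedVolume_eq_zero hn hb ho (by omega), expectedVolume_eq_zero hn hb ho (by omega),
      zero_add, mul_eq_zero] at this
    exact this.resolve_right hV
  have := hsum (q.cube.volume + 1)
  rw [expectedVolume_eq_zero hn hb ho (by omega), zero_add] at this
  rw [expectedReward_eq, tsum_eq_sum hzero]
  exact (ENNReal.mul_left_inj hV hV').1 (this.trans (one_mul _).symm)

lemma expectedEpisodes_ne_top : expectedEpisodes q n b o ≠ ⊤ := by
  have hzero : ∀ k ∉ Finset.range (q.cube.volume + 1),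
      (remaining q n b o k).toOuterMeasure {U | U ≠ 0} = 0 := by
    intro k hk
    rw [Finset.mem_range, not_lt] at hk
    rw [PMF.toOuterMeasure_apply_eq_zero_iff, Set.disjoint_left]
    exact fun U hU h => h (remaining_eq_zero hn hb ho (by omega) hU)
  rw [expectedEpisodes, tsum_eq_sum hzero]
  refine ENNReal.sum_ne_top.2 fun k _ => ne_top_of_le_ne_top ENNReal.one_ne_top ?_
  rw [PMF.toOuterMeasure_apply, ← (remaining q n b o k).tsum_coe]
  exact ENNReal.tsum_le_tsum fun U => Set.indicator_le_self _ _ U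

lemma expectedEpisodes_ne_zero : expectedEpisodes q n b o ≠ 0 := by
  intro h
  rw [expectedEpisodes, ENNReal.tsum_eq_zero] at h
  have h := h 0
  rw [PMF.toOuterMeasure_apply_eq_zero_iff, remaining, PMF.support_pure,
    Set.disjoint_singleton_left] at h
  refine h fun h0 => q.volume_cube_pos.ne' ?_
  rw [← totalVolume_initCubes q hn, h0, totalVolume_zero]

lemma averageReward_eq : averageReward q n b o = (expectedEpisodes q n b o).toReal⁻¹ := by
  rw [averageReward, expectedReward_eq_one hn hb ho, one_div, ENNReal.toReal_inv]

lemma expectedSteps_le_iff {o' : List A} (ho' : o'.Nodup) :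
    expectedSteps q n b o ≤ expectedSteps q n b o' ↔
      averageReward q n b o' ≤ averageReward q n b o := by
  have hnb : (n * b : ℝ≥0∞) ≠ 0 := by
    exact_mod_cast (Nat.mul_pos hn hb).ne'
  have hnb' : (n * b : ℝ≥0∞) ≠ ⊤ := by
    exact_mod_cast ENNReal.natCast_ne_top (n * b)
  have h₁ := expectedEpisodes_ne_top (q := q) hn hb ho
  have h₂ := expectedEpisodes_ne_top (q := q) hn hb ho'
  have h₃ := ENNReal.toReal_pos (expectedEpisodes_ne_zero (q := q) hn hb ho) h₁
  have h₄ := ENNReal.toReal_pos (expectedEpisodes_ne_zero (q := q) hn hb ho') h₂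
  rw [expectedSteps, expectedSteps, ENNReal.mul_le_mul_iff_right hnb hnb',
    averageReward_eq hn hb ho, averageReward_eq hn hb ho', inv_le_inv₀ h₄ h₃,
    ENNReal.toReal_le_toReal h₁ h₂]

end Episodes

/-! ### The UCB rule at one node -/

lemma tendsto_atTop_or_bounded {f : ℕ → ℕ} (hf : Monotone f) :
    Tendsto f atTop atTop ∨ ∃ B, ∀ t, f t ≤ B := by
  by_cases h : ∃ B, ∀ t, f t ≤ B
  · exact Or.inr h
  · push Not at h
    exact Or.inl (tendsto_atTop_atTop_of_monotone hf fun B => (h B).imp fun _ ht => ht.le)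

lemma frequently_lt_succ {f : ℕ → ℕ} (hf : Tendsto f atTop atTop) :
    ∃ᶠ t in atTop, f t < f (t + 1) := by
  intro h
  obtain ⟨t₀, h⟩ := eventually_atTop.1 h
  have hle : ∀ t ≥ t₀, f t ≤ f t₀ := fun t ht => by
    induction t, ht using Nat.le_induction with
    | base => exact le_rfl
    | succ t ht ih => exact (not_lt.1 (h t ht)).trans ih
  obtain ⟨t, ht, ht'⟩ := ((eventually_ge_atTop t₀).and (hf.eventually_gt_atTop (f t₀))).exists
  exact (hle t ht).not_gt ht'

/-- A node with children `s` at which children are chosen by the UCB rule: `N` and `n` are the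
counts at the node and at its children, `m` are the means at the children. -/
structure UCBProcess {ι : Type*} (s : Finset ι) (C : ℝ) (N : ℕ → ℕ) (n : ι → ℕ → ℕ)
    (m : ι → ℕ → ℝ) : Prop where
  mono : ∀ i ∈ s, Monotone (n i)
  step : ∀ i ∈ s, ∀ t, n i (t + 1) ≤ n i t + 1
  mono_parent : Monotone N
  tendsto_parent : Tendsto N atTop atTop
  -- The episode that creates a non-root node is not recorded below it, so the counts agree only up
  -- to a constant.
  sum_eq : ∃ c : ℤ, ∀ᶠ t in atTop, (N t : ℤ) = ∑ i ∈ s, (n i t : ℤ) + c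
  mean_mem : ∀ i ∈ s, ∀ t, m i t ∈ Set.Icc (0 : ℝ) 1
  -- A child with count 0 may be chosen without comparison, whence the condition `n i t ≠ 0`.
  rule : ∀ i ∈ s, ∀ᶠ t in atTop, n i t < n i (t + 1) → n i t ≠ 0 → ∀ j ∈ s, n j t ≠ 0 ∧
    m j t + C * √(Real.log (N t) / n j t) ≤ m i t + C * √(Real.log (N t) / n i t)

namespace UCBProcess

variable {ι : Type*} {s : Finset ι} {C : ℝ} {N : ℕ → ℕ} {n : ι → ℕ → ℕ} {m : ι → ℕ → ℝ}

lemma tendsto_log (h : UCBProcess s C N n m) :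
    Tendsto (fun t => Real.log (N t)) atTop atTop :=
  Real.tendsto_log_atTop.comp (tendsto_natCast_atTop_atTop.comp h.tendsto_parent)

lemma exists_tendsto (h : UCBProcess s C N n m) : ∃ i ∈ s, Tendsto (n i) atTop atTop := by
  by_contra hcon
  push Not at hcon
  have hB : ∀ i, ∃ B, i ∈ s → ∀ t, n i t ≤ B := fun i => by
    by_cases hi : i ∈ s
    · exact ((tendsto_atTop_or_bounded (h.mono i hi)).resolve_left (hcon i hi)).imp
        fun B hB _ => hB
    · exact ⟨0, fun hi' => (hi hi').elim⟩
  choose B hB using hB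
  obtain ⟨c, hc⟩ := h.sum_eq
  obtain ⟨t, ht, ht'⟩ :=
    (hc.and (h.tendsto_parent.eventually_gt_atTop (∑ i ∈ s, B i + c.toNat))).exists
  have : ∑ i ∈ s, n i t ≤ ∑ i ∈ s, B i := Finset.sum_le_sum fun i hi => hB i hi t
  have : ∑ i ∈ s, (n i t : ℤ) ≤ ∑ i ∈ s, (B i : ℤ) := by exact_mod_cast this
  have : ((∑ i ∈ s, B i : ℕ) : ℤ) = ∑ i ∈ s, (B i : ℤ) := by push_cast; rfl
  omega

/-- If `n j ≤ B`, the bonus of `j` tends to infinity. A child `i` chosen infinitely often eventually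
has at most half of that bonus, and means in `[0, 1]` cannot make up for the difference, so `i`
would lose to `j`. -/
lemma tendsto_count (h : UCBProcess s C N n m) (hC : 0 < C) {j : ι} (hj : j ∈ s) :
    Tendsto (n j) atTop atTop := by
  refine (tendsto_atTop_or_bounded (h.mono j hj)).resolve_right ?_
  rintro ⟨B, hB⟩
  obtain ⟨i, hi, hni⟩ := h.exists_tendsto
  set B' : ℝ := B + 1 with hB'
  have hB'pos : 0 < B' := by positivity
  -- The factor 4 in the count halves the square root. The bound on the logarithm makes half the
  -- bonus of `j` exceed 1, the largest possible difference of means.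
  obtain ⟨t, ht, hrule, hlarge, hlog⟩ := ((frequently_lt_succ hni).and_eventually
    ((h.rule i hi).and ((hni.eventually_ge_atTop (4 * (B + 1))).and
      (h.tendsto_log.eventually_gt_atTop (4 * B' / C ^ 2))))).exists
  obtain ⟨hj0, hucb⟩ := hrule ht (by omega) j hj
  set L := Real.log (N t)
  have hL : 0 < L := lt_of_le_of_lt (by positivity) hlog
  have hnj : (0 : ℝ) < n j t := by exact_mod_cast Nat.pos_of_ne_zero hj0
  have h₁ : √(L / B') ≤ √(L / n j t) := by
    refine Real.sqrt_le_sqrt (div_le_div_of_nonneg_left hL.le hnj ?_)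
    have : (n j t : ℝ) ≤ B := by exact_mod_cast hB t
    linarith
  have h₂ : √(L / n i t) ≤ √(L / B') / 2 := by
    have e : √(L / B') / 2 = √(L / (4 * B')) := by
      rw [show L / (4 * B') = L / B' / 2 ^ 2 by field_simp; norm_num,
        Real.sqrt_div' (L / B') (y := 2 ^ 2) (by norm_num), Real.sqrt_sq (by norm_num)]
    rw [e]
    refine Real.sqrt_le_sqrt (div_le_div_of_nonneg_left hL.le (by positivity) ?_)
    rw [hB']
    exact_mod_cast hlarge
  have h₃ : 2 / C < √(L / B') := by
    rw [Real.lt_sqrt (by positivity), lt_div_iff₀ hB'pos]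
    calc (2 / C) ^ 2 * B' = 4 * B' / C ^ 2 := by ring
      _ < L := hlog
  rw [div_lt_iff₀ hC] at h₃
  have := (h.mean_mem i hi t).2
  have := (h.mean_mem j hj t).1
  have := mul_le_mul_of_nonneg_left h₁ hC.le
  have := mul_le_mul_of_nonneg_left h₂ hC.le
  linarith

/-- Whenever `i` is chosen, its bonus must cover the gap between the means, which gives `n i ≤ K log
N` at that time. Since `n i` grows only then, and by one, it stays `O(log N)`. -/
lemma count_ratio_tendsto_zero (h : UCBProcess s C N n m) (hC : 0 < C) {i j : ι} (hi : i ∈ s)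
    (hj : j ∈ s) {v w : ℝ} (hvw : v < w) (hv : Tendsto (m i) atTop (𝓝 v))
    (hw : Tendsto (m j) atTop (𝓝 w)) :
    Tendsto (fun t => (n i t : ℝ) / N t) atTop (𝓝 0) := by
  -- One third of the gap is allowed for the error of each mean; the last third must come from the
  -- bonus.
  set δ := (w - v) / 3 with hδ
  have hδpos : 0 < δ := by positivity
  set K := (C / δ) ^ 2
  have hK : 0 < K := by positivity
  have hstep : ∀ᶠ t in atTop, n i t < n i (t + 1) → (n i t : ℝ) ≤ K * Real.log (N t) := by
    filter_upwards [h.rule i hi, (h.tendsto_count hC hi).eventually_gt_atTop 0,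
      hv.eventually_lt_const (show v < v + δ by linarith),
      hw.eventually_const_lt (show w - δ < w by linarith),
      h.tendsto_log.eventually_gt_atTop 0] with t hrule hpos h₁ h₂ hL hinc
    obtain ⟨-, hucb⟩ := hrule hinc hpos.ne' j hj
    have h₀ : 0 ≤ C * √(Real.log (N t) / n j t) := by positivity
    have h₃ : δ ≤ C * √(Real.log (N t) / n i t) := by linarith
    have hn : (0 : ℝ) < n i t := by exact_mod_cast hpos
    rw [← div_le_iff₀' hC, Real.le_sqrt' (by positivity), le_div_iff₀ hn] at h₃
    calc (n i t : ℝ) = K * ((δ / C) ^ 2 * n i t) := by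
          simp only [K]
          field_simp
      _ ≤ K * Real.log (N t) := mul_le_mul_of_nonneg_left h₃ hK.le
  obtain ⟨t₀, hstep⟩ := eventually_atTop.1 (hstep.and (h.tendsto_parent.eventually_ge_atTop 1))
  have hbound : ∀ t ≥ t₀, (n i t : ℝ) ≤ n i t₀ + 1 + K * Real.log (N t) := by
    intro t ht
    induction t, ht using Nat.le_induction with
    | base =>
      have : 0 ≤ Real.log (N t₀) := Real.log_natCast_nonneg _
      nlinarith
    | succ t ht ih =>
      have hN : Real.log (N t) ≤ Real.log (N (t + 1)) :=
        Real.log_le_log (by exact_mod_cast (hstep t ht).2)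
          (by exact_mod_cast h.mono_parent (Nat.le_succ t))
      have hKN := mul_le_mul_of_nonneg_left hN hK.le
      by_cases hinc : n i t < n i (t + 1)
      · have h₁ := (hstep t ht).1 hinc
        have h₂ : (n i (t + 1) : ℝ) ≤ n i t + 1 := by exact_mod_cast h.step i hi t
        have : (0 : ℝ) ≤ n i t₀ := Nat.cast_nonneg _
        linarith
      · have : (n i (t + 1) : ℝ) ≤ n i t := by exact_mod_cast not_lt.1 hinc
        linarith
  have hNR : Tendsto (fun t => (N t : ℝ)) atTop atTop :=
    tendsto_natCast_atTop_atTop.comp h.tendsto_parent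
  have hlim : Tendsto (fun t => ((n i t₀ + 1 : ℝ)) / N t + K * (Real.log (N t) / N t)) atTop
      (𝓝 0) := by
    have h₁ := (tendsto_const_nhds (x := (n i t₀ + 1 : ℝ))).div_atTop hNR
    have h₂ := ((Real.isLittleO_log_id_atTop.tendsto_div_nhds_zero).comp hNR).const_mul K
    simpa using h₁.add h₂
  refine tendsto_of_tendsto_of_tendsto_of_le_of_le' tendsto_const_nhds hlim
    (Eventually.of_forall fun t => by positivity) ?_
  filter_upwards [eventually_ge_atTop t₀] with t ht
  rw [← mul_div_assoc, ← add_div]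
  exact div_le_div_of_nonneg_right (hbound t ht) (Nat.cast_nonneg _)

lemma exists_count_le (h : UCBProcess s C N n m) :
    ∃ K : ℝ, ∀ i ∈ s, ∀ᶠ t in atTop, (n i t : ℝ) / N t ≤ K := by
  obtain ⟨c, hc⟩ := h.sum_eq
  refine ⟨1 + |(c : ℝ)|, fun i hi => ?_⟩
  filter_upwards [hc, h.tendsto_parent.eventually_ge_atTop 1] with t ht hN
  have hN' : (1 : ℝ) ≤ N t := by exact_mod_cast hN
  have h₁ : (n i t : ℤ) ≤ ∑ i ∈ s, (n i t : ℤ) :=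
    Finset.single_le_sum (f := fun i => (n i t : ℤ)) (fun _ _ => Int.natCast_nonneg _) hi
  have h₂ : (n i t : ℤ) ≤ N t - c := by linarith
  have h₃ : (n i t : ℝ) ≤ N t - c := by exact_mod_cast h₂
  rw [div_le_iff₀ (by linarith)]
  have := neg_abs_le (c : ℝ)
  nlinarith [abs_nonneg (c : ℝ)]

/-- Up to `O(1/N)`, `y/N - v` is the sum of `(m i - v) * (n i / N)`. In each term either `m i → v`
with bounded weight, or the weight tends to 0 with `m i - v` convergent. -/
lemma mean_tendsto (h : UCBProcess s C N n m) (hC : 0 < C) {x : ι → ℕ → ℝ} {y : ℕ → ℝ}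
    (hm : ∀ i ∈ s, ∀ t, m i t = x i t / n i t)
    (hy : ∃ c : ℝ, ∀ᶠ t in atTop, y t = ∑ i ∈ s, x i t + c)
    {V : ι → ℝ} {v : ℝ} (hV : ∀ i ∈ s, Tendsto (m i) atTop (𝓝 (V i)))
    (hle : ∀ i ∈ s, V i ≤ v) {j : ι} (hj : j ∈ s) (hjv : V j = v) :
    Tendsto (fun t => y t / N t) atTop (𝓝 v) := by
  obtain ⟨c, hy⟩ := hy
  obtain ⟨c', hN⟩ := h.sum_eq
  obtain ⟨K, hK⟩ := h.exists_count_le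
  have hterm : ∀ i ∈ s, Tendsto (fun t => (m i t - v) * (n i t / N t)) atTop (𝓝 0) := by
    intro i hi
    rcases (hle i hi).lt_or_eq with hlt | heq
    · have h₁ := h.count_ratio_tendsto_zero hC hi hj (hjv ▸ hlt) (hV i hi) (hV j hj)
      simpa using ((hV i hi).sub_const v).mul h₁
    · have h₁ : Tendsto (fun t => m i t - v) atTop (𝓝 0) := by
        simpa [heq] using (hV i hi).sub_const v
      have h₂ : Tendsto (fun t => |m i t - v| * K) atTop (𝓝 0) := by
        simpa using h₁.abs.mul_const K
      refine squeeze_zero_norm' ?_ h₂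
      filter_upwards [hK i hi] with t ht
      rw [Real.norm_eq_abs, abs_mul, abs_of_nonneg (a := (n i t : ℝ) / N t) (by positivity)]
      exact mul_le_mul_of_nonneg_left ht (abs_nonneg _)
  have hNR : Tendsto (fun t => (N t : ℝ)) atTop atTop :=
    tendsto_natCast_atTop_atTop.comp h.tendsto_parent
  have hlim : Tendsto (fun t => v + (∑ i ∈ s, (m i t - v) * (n i t / N t) +
      (c - v * c') / N t)) atTop (𝓝 v) := by
    have h₁ := tendsto_finsetSum s hterm
    have h₂ := (tendsto_const_nhds (x := c - v * c')).div_atTop hNR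
    simpa using (h₁.add h₂).const_add v
  refine hlim.congr' ?_
  have hpos : ∀ᶠ t in atTop, ∀ i ∈ s, 0 < n i t :=
    (Filter.eventually_all_finset s).2 fun i hi => (h.tendsto_count hC hi).eventually_gt_atTop 0
  filter_upwards [hy, hN, hpos, h.tendsto_parent.eventually_gt_atTop 0] with t hy hN hpos hN0
  have hN0' : (N t : ℝ) ≠ 0 := by exact_mod_cast hN0.ne'
  have hN' : (N t : ℝ) = ∑ i ∈ s, (n i t : ℝ) + c' := by exact_mod_cast hN
  have hx : ∑ i ∈ s, (m i t - v) * (n i t / N t) =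
      (∑ i ∈ s, x i t - v * ∑ i ∈ s, (n i t : ℝ)) / N t := by
    rw [Finset.mul_sum, ← Finset.sum_sub_distrib, Finset.sum_div]
    refine Finset.sum_congr rfl fun i hi => ?_
    have : (n i t : ℝ) ≠ 0 := by exact_mod_cast (hpos i hi).ne'
    rw [hm i hi]
    field_simp
  rw [hx, hy, ← add_div, eq_div_iff hN0', add_mul, div_mul_cancel₀ _ hN0']
  rw [hN']
  ring

end UCBProcess

section Orders

variable {A : Type*} [Fintype A] [DecidableEq A]

/-! ### Prefixes of attribute orders -/

/-- Each attribute of `p` after the first connects to an earlier one, without repetitions. -/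
def Query.IsValid (q : Query A) (p : List A) : Prop :=
  ∀ p' a, p' ++ [a] <+: p → q.Action p' a

variable {q : Query A} {p o : List A} {a : A}

lemma Query.isValid_nil (q : Query A) : q.IsValid [] := by
  intro p' a h
  simp at h

lemma Query.IsOrder.isValid (h : q.IsOrder o) : q.IsValid o := h.2

lemma Query.IsValid.of_prefix {p' : List A} (h : q.IsValid p) (hp : p' <+: p) : q.IsValid p' :=
  fun p'' a h' => h p'' a (h'.trans hp)

lemma Query.IsValid.append (h : q.IsValid p) (ha : q.Action p a) : q.IsValid (p ++ [a]) := by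
  intro p' a' h'
  rcases List.prefix_concat_iff.1 h' with h' | h'
  · obtain ⟨rfl, e⟩ := List.append_inj' h' rfl
    rw [List.cons.injEq] at e
    exact e.1 ▸ ha
  · exact h p' a' h'

lemma Query.IsValid.nodup (h : q.IsValid p) : p.Nodup := by
  induction p using List.reverseRecOn with
  | nil => exact List.nodup_nil
  | append_singleton p a ih =>
    have ha := (h p a (List.prefix_refl _)).1
    have hp := ih (h.of_prefix (List.prefix_append _ _))
    exact (List.nodup_append.2 ⟨hp, List.nodup_singleton a, fun x hx y hy e => by
      rw [List.mem_singleton] at hy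
      exact ha (hy ▸ e ▸ hx)⟩)

lemma Query.IsOrder.length_eq (h : q.IsOrder o) : o.length = Fintype.card A := by
  rw [← List.toFinset_card_of_nodup h.isValid.nodup, ← Finset.card_univ]
  congr 1
  ext a
  simp [h.1 a]

lemma Query.IsOrder.prefix_iff {o' : List A} (h : q.IsOrder o) (h' : q.IsOrder o') :
    o <+: o' ↔ o' = o :=
  ⟨fun hp => (hp.eq_of_length (h.length_eq.trans h'.length_eq.symm)).symm, fun e => e ▸ List.prefix_refl _⟩

lemma Query.finite_isValid (q : Query A) : {p | q.IsValid p}.Finite :=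
  (List.finite_length_le A (Fintype.card A)).subset fun _ hp => hp.nodup.length_le_card

/-- On a path of connections from an attribute of `p` to one outside, some step leaves `p`. -/
lemma Query.exists_action (hq : ∀ a a', Relation.ReflTransGen q.Connects a a')
    (hp : ∃ x, x ∉ p) : ∃ a, q.Action p a := by
  obtain ⟨x, hx⟩ := hp
  rcases p.eq_nil_or_concat with rfl | ⟨p', y, hy⟩
  · exact ⟨x, hx, Or.inl rfl⟩
  · have hyp : y ∈ p := by simp [hy]
    by_contra hcon
    push Not at hcon
    refine hx ?_
    induction hq y x with
    | refl => exact hyp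
    | @tail u w _ huw ih =>
      by_contra hw
      refine hcon w ⟨hw, Or.inr ⟨u, by_contra fun hu => hu (ih hu), ?_⟩⟩
      rcases huw with ⟨R, hR, h₁, h₂⟩ | ⟨R, hR, h₁, h₂⟩
      exacts [Or.inl ⟨R, hR, h₂, h₁⟩, Or.inr ⟨R, hR, h₂, h₁⟩]

/-- Backward induction on the number of missing attributes: a valid prefix of full length is a
complete order. -/
lemma Query.IsValid.induction_up {P : List A → Prop} (full : ∀ o, q.IsOrder o → P o)
    (step : ∀ p, q.IsValid p → (∃ x, x ∉ p) → (∀ a, q.Action p a → P (p ++ [a])) → P p)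
    (hp : q.IsValid p) : P p := by
  induction hk : Fintype.card A - p.length generalizing p with
  | zero =>
    refine full p ⟨fun a => ?_, hp⟩
    have := hp.nodup.length_le_card
    have h : p.toFinset = Finset.univ := by
      rw [← Finset.card_eq_iff_eq_univ, List.toFinset_card_of_nodup hp.nodup]
      omega
    exact List.mem_toFinset.1 (h ▸ Finset.mem_univ a)
  | succ k ih =>
    refine step p hp ?_ fun a ha => ih (hp.append ha) (by simp; omega)
    by_contra! h
    have := (Query.IsOrder.length_eq (q := q) (o := p) ⟨h, hp⟩)
    omega

lemma Query.IsValid.exists_isOrder (hq : ∀ a a', Relation.ReflTransGen q.Connects a a')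
    (hp : q.IsValid p) : ∃ o, q.IsOrder o ∧ p <+: o := by
  refine hp.induction_up (P := fun p => ∃ o, q.IsOrder o ∧ p <+: o) (fun o ho => ⟨o, ho, List.prefix_refl _⟩) fun p _ hx ih => ?_
  obtain ⟨a, ha⟩ := Query.exists_action hq hx
  obtain ⟨o, ho, hpo⟩ := ih a ha
  exact ⟨o, ho, (List.prefix_append _ _).trans hpo⟩

lemma exists_append_prefix (ho : q.IsOrder o) (hp : p <+: o) (hx : ∃ x, x ∉ p) :
    ∃ a, p ++ [a] <+: o := by
  obtain ⟨l, rfl⟩ := hp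
  match l with
  | [] =>
    obtain ⟨x, hx⟩ := hx
    exact (hx (by simpa using ho.1 x)).elim
  | a :: l => exact ⟨a, l, by simp⟩

lemma append_prefix_unique {a' : A} (h : p ++ [a] <+: o) (h' : p ++ [a'] <+: o) : a = a' := by
  have := List.prefix_of_prefix_length_le h h' (by simp)
  simpa using this.eq_of_length (by simp)

/-! ### Values of prefixes -/

/-- The largest value of `r` at an order that extends `p`. -/
noncomputable def Query.value (q : Query A) (r : List A → ℝ) (p : List A) : ℝ :=
  sSup (r '' {o | q.IsOrder o ∧ p <+: o})

variable {r : List A → ℝ}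

lemma Query.finite_extensions (q : Query A) (r : List A → ℝ) (p : List A) :
    (r '' {o | q.IsOrder o ∧ p <+: o}).Finite :=
  (q.finite_isValid.subset fun _ ho => ho.1.isValid).image r

lemma Query.le_value (ho : q.IsOrder o) (hp : p <+: o) : r o ≤ q.value r p :=
  le_csSup (q.finite_extensions r p).bddAbove ⟨o, ⟨ho, hp⟩, rfl⟩

lemma Query.IsValid.exists_eq_value (hq : ∀ a a', Relation.ReflTransGen q.Connects a a')
    (hp : q.IsValid p) : ∃ o, q.IsOrder o ∧ p <+: o ∧ r o = q.value r p := by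
  obtain ⟨o, ho, hpo⟩ := hp.exists_isOrder hq
  obtain ⟨o', h, e⟩ := Set.Nonempty.csSup_mem (s := r '' {o | q.IsOrder o ∧ p <+: o})
    ⟨r o, o, ⟨ho, hpo⟩, rfl⟩ (q.finite_extensions r p)
  exact ⟨o', h.1, h.2, e⟩

lemma Query.IsOrder.value_eq (ho : q.IsOrder o) : q.value r o = r o := by
  have : {o' | q.IsOrder o' ∧ o <+: o'} = {o} := by
    ext o'
    refine ⟨fun h => (ho.prefix_iff h.1).1 h.2, ?_⟩
    rintro rfl
    exact ⟨ho, List.prefix_refl _⟩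
  rw [Query.value, this, Set.image_singleton, csSup_singleton]

lemma Query.IsValid.value_append_le (hq : ∀ a a', Relation.ReflTransGen q.Connects a a')
    (hp : q.IsValid (p ++ [a])) : q.value r (p ++ [a]) ≤ q.value r p := by
  obtain ⟨o, ho, hpo, e⟩ := hp.exists_eq_value hq (r := r)
  exact e ▸ Query.le_value ho ((List.prefix_append _ _).trans hpo)

lemma Query.IsValid.exists_value_append_eq (hq : ∀ a a', Relation.ReflTransGen q.Connects a a')
    (hp : q.IsValid p) (hx : ∃ x, x ∉ p) :
    ∃ a, q.Action p a ∧ q.value r (p ++ [a]) = q.value r p := by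
  obtain ⟨o, ho, hpo, e⟩ := hp.exists_eq_value hq (r := r)
  obtain ⟨a, ha⟩ := exists_append_prefix ho hpo hx
  refine ⟨a, ho.2 p a ha, le_antisymm ?_ (e ▸ Query.le_value ho ha)⟩
  exact (ho.isValid.of_prefix ha).value_append_le hq

lemma forall_le_iff_value_le (hq : ∀ a a', Relation.ReflTransGen q.Connects a a') :
    (∀ o', q.IsOrder o' → r o' ≤ r o) ↔ q.value r [] ≤ r o := by
  refine ⟨fun h => ?_, fun h o' ho' => (Query.le_value ho' List.nil_prefix).trans h⟩
  obtain ⟨o', ho', -, e⟩ := q.isValid_nil.exists_eq_value hq (r := r)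
  exact e ▸ h o' ho'

end Orders

/-! ### Statistics of the search tree -/

section Statistics

variable {A : Type*} [DecidableEq A] {X : List A → ℕ → ℝ} {sel : ℕ → List A}

/-- The reward of episode `t` is recorded at the node `p`. -/
def Recorded (X : List A → ℕ → ℝ) (sel : ℕ → List A) (t : ℕ) (p : List A) : Prop :=
  p <+: sel t ∧ (p.dropLast = [] ∨ 0 < (stats X sel t).count p.dropLast)

open Classical in
lemma count_succ (t : ℕ) (p : List A) : (stats X sel (t + 1)).count p =
    (stats X sel t).count p + if Recorded X sel t p then 1 else 0 := by
  by_cases h : Recorded X sel t p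
  · rw [if_pos h]
    exact if_pos h
  · rw [if_neg h]
    exact if_neg h

open Classical in
lemma total_succ (t : ℕ) (p : List A) : (stats X sel (t + 1)).total p =
    (stats X sel t).total p + if Recorded X sel t p then episodeReward X sel t else 0 := by
  by_cases h : Recorded X sel t p
  · rw [if_pos h]
    exact if_pos h
  · rw [if_neg h, add_zero]
    exact if_neg h

lemma count_zero (p : List A) : (stats X sel 0).count p = 0 := rfl

lemma total_zero (p : List A) : (stats X sel 0).total p = 0 := rfl

lemma count_mono (p : List A) : Monotone fun t => (stats X sel t).count p := by
  refine monotone_nat_of_le_succ fun t => ?_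
  rw [count_succ]
  exact Nat.le_add_right _ _

lemma count_nil (t : ℕ) : (stats X sel t).count [] = t := by
  induction t with
  | zero => rfl
  | succ t ih =>
    rw [count_succ, ih, if_pos ⟨List.nil_prefix, Or.inl rfl⟩]

lemma count_le_episodes (p : List A) (t : ℕ) : (stats X sel t).count p ≤ t := by
  classical
  induction t with
  | zero => rfl
  | succ t ih =>
    rw [count_succ]
    split_ifs <;> omega

/-- If the parent prefix is selected infinitely often, it gets a node at some time and keeps it;
otherwise `p` too is selected only finitely often. -/
lemma eventually_recorded (p : List A) : ∀ᶠ t in atTop, (Recorded X sel t p ↔ p <+: sel t) := by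
  suffices h : ∀ᶠ t in atTop, (p <+: sel t → Recorded X sel t p) by
    filter_upwards [h] with t ht
    exact ⟨fun h => h.1, ht⟩
  induction p using List.reverseRecOn with
  | nil => exact Eventually.of_forall fun t h => ⟨h, Or.inl rfl⟩
  | append_singleton p a ih =>
    by_cases hp : ∃ᶠ t in atTop, p <+: sel t
    · obtain ⟨t₁, h₁, h₂⟩ := (hp.and_eventually ih).exists
      have hpos : 0 < (stats X sel (t₁ + 1)).count p := by
        rw [count_succ, if_pos (h₂ h₁)]
        exact Nat.succ_pos _
      filter_upwards [eventually_ge_atTop (t₁ + 1)] with t ht h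
      refine ⟨h, Or.inr ?_⟩
      rw [List.dropLast_concat]
      exact hpos.trans_le (count_mono p ht)
    · filter_upwards [not_frequently.1 hp] with t ht h
      exact (ht ((List.prefix_append _ _).trans h)).elim

lemma total_mem (hr : ∀ t, episodeReward X sel t ∈ Set.Icc (0 : ℝ) 1) (p : List A) (t : ℕ) :
    (stats X sel t).total p ∈ Set.Icc (0 : ℝ) ((stats X sel t).count p) := by
  classical
  induction t with
  | zero => simp [count_zero, total_zero]
  | succ t ih =>
    rw [count_succ, total_succ]
    obtain ⟨h₁, h₂⟩ := ih
    obtain ⟨h₃, h₄⟩ := hr t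
    split_ifs
    · push_cast
      exact ⟨by linarith, by linarith⟩
    · simpa using ⟨h₁, h₂⟩

lemma mean_mem (hr : ∀ t, episodeReward X sel t ∈ Set.Icc (0 : ℝ) 1) (p : List A) (t : ℕ) :
    (stats X sel t).mean p ∈ Set.Icc (0 : ℝ) 1 := by
  obtain ⟨h₁, h₂⟩ := total_mem hr p t
  exact ⟨div_nonneg h₁ (Nat.cast_nonneg _), div_le_one_of_le₀ h₂ (Nat.cast_nonneg _)⟩

lemma exists_eventually_eq_const {G : Type*} {f : ℕ → G}
    (h : ∀ᶠ t in atTop, f (t + 1) = f t) : ∃ c, ∀ᶠ t in atTop, f t = c := by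
  obtain ⟨t₀, h⟩ := eventually_atTop.1 h
  refine ⟨f t₀, eventually_atTop.2 ⟨t₀, fun t ht => ?_⟩⟩
  induction t, ht using Nat.le_induction with
  | base => rfl
  | succ t ht ih => rw [h t ht, ih]

end Statistics

section Convergence

variable {A : Type*} [Fintype A] [DecidableEq A] {q : Query A} {C : ℝ} {X : List A → ℕ → ℝ}
  {sel : ℕ → List A} {p o : List A} {r : List A → ℝ}

/-! ### Runs of UCT -/

open Classical in
/-- The attributes that may be appended to `p`. -/
noncomputable def Query.actions (q : Query A) (p : List A) : Finset A :=
  Finset.univ.filter (q.Action p)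

lemma Query.mem_actions {a : A} : a ∈ q.actions p ↔ q.Action p a := by
  simp [Query.actions]

lemma IsRun.isOrder (hrun : IsRun q C X sel) (t : ℕ) : q.IsOrder (sel t) := (hrun t).1

lemma IsRun.reward_mem (hrun : IsRun q C X sel)
    (hX : ∀ o, q.IsOrder o → ∀ k, X o k ∈ Set.Icc (0 : ℝ) 1) (t : ℕ) :
    episodeReward X sel t ∈ Set.Icc (0 : ℝ) 1 :=
  hX _ (hrun.isOrder t) _

-- An episode through an incomplete `p` passes through exactly one child. Used with `y = 1` for
-- counts and with the rewards for totals.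
open Classical in
lemma IsRun.sum_children (hrun : IsRun q C X sel) (hx : ∃ x, x ∉ p) {M : Type*}
    [AddCommMonoid M] (y : ℕ → M) :
    ∀ᶠ t in atTop, ∑ a ∈ q.actions p, (if Recorded X sel t (p ++ [a]) then y t else 0) =
      if Recorded X sel t p then y t else 0 := by
  have hall : ∀ᶠ t in atTop, ∀ a, (Recorded X sel t (p ++ [a]) ↔ p ++ [a] <+: sel t) :=
    eventually_all.2 fun a => eventually_recorded (p ++ [a])
  filter_upwards [hall, eventually_recorded (X := X) (sel := sel) p] with t h₁ h₂
  simp only [h₁, h₂]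
  by_cases hp : p <+: sel t
  · obtain ⟨a, ha⟩ := exists_append_prefix (hrun.isOrder t) hp hx
    rw [if_pos hp, Finset.sum_eq_single a, if_pos ha]
    · exact fun a' _ hne => if_neg fun ha' => hne (append_prefix_unique ha' ha)
    · exact fun hn => (hn (Query.mem_actions.2 ((hrun.isOrder t).2 p a ha))).elim
  · rw [if_neg hp]
    exact Finset.sum_eq_zero fun a _ => if_neg fun ha => hp ((List.prefix_append _ _).trans ha)

lemma IsRun.count_eq_sum (hrun : IsRun q C X sel) (hx : ∃ x, x ∉ p) :
    ∃ c : ℤ, ∀ᶠ t in atTop, ((stats X sel t).count p : ℤ) =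
      ∑ a ∈ q.actions p, ((stats X sel t).count (p ++ [a]) : ℤ) + c := by
  classical
  obtain ⟨c, hc⟩ := exists_eventually_eq_const (f := fun t => ((stats X sel t).count p : ℤ) -
      ∑ a ∈ q.actions p, ((stats X sel t).count (p ++ [a]) : ℤ)) (by
    filter_upwards [hrun.sum_children hx fun _ => (1 : ℤ)] with t ht
    simp only [count_succ]
    push_cast
    rw [Finset.sum_add_distrib, ht]
    ring)
  exact ⟨c, hc.mono fun t ht => by linarith⟩

lemma IsRun.total_eq_sum (hrun : IsRun q C X sel) (hx : ∃ x, x ∉ p) :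
    ∃ c : ℝ, ∀ᶠ t in atTop, (stats X sel t).total p =
      ∑ a ∈ q.actions p, (stats X sel t).total (p ++ [a]) + c := by
  classical
  obtain ⟨c, hc⟩ := exists_eventually_eq_const (f := fun t => (stats X sel t).total p -
      ∑ a ∈ q.actions p, (stats X sel t).total (p ++ [a])) (by
    filter_upwards [hrun.sum_children hx fun t => episodeReward X sel t] with t ht
    simp only [total_succ]
    rw [Finset.sum_add_distrib, ht]
    ring)
  exact ⟨c, hc.mono fun t ht => by linarith⟩

lemma IsRun.ucbProcess (hrun : IsRun q C X sel)
    (hX : ∀ o, q.IsOrder o → ∀ k, X o k ∈ Set.Icc (0 : ℝ) 1) (hx : ∃ x, x ∉ p)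
    (hp : Tendsto (fun t => (stats X sel t).count p) atTop atTop) :
    UCBProcess (q.actions p) C (fun t => (stats X sel t).count p)
      (fun a t => (stats X sel t).count (p ++ [a])) (fun a t => (stats X sel t).mean (p ++ [a])) where
  mono a _ := count_mono _
  step a _ t := by
    classical
    simp only [count_succ]
    split_ifs <;> omega
  mono_parent := count_mono _
  tendsto_parent := hp
  sum_eq := hrun.count_eq_sum hx
  mean_mem a _ t := mean_mem (hrun.reward_mem hX) _ t
  rule a ha := Eventually.of_forall fun t hlt hne a' ha' => by
    classical
    have hrec : Recorded X sel t (p ++ [a]) := by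
      by_contra hcon
      rw [count_succ, if_neg hcon, add_zero] at hlt
      exact lt_irrefl _ hlt
    obtain ⟨-, h₁, h₂⟩ := (hrun t).2 p a hrec.1
    have hall : ∀ a', q.Action p a' → (stats X sel t).count (p ++ [a']) ≠ 0 :=
      fun a' ha' h0 => hne (h₁ ⟨a', ha', h0⟩)
    rw [Query.mem_actions] at ha'
    exact ⟨hall a' ha', h₂ hall a' ha'⟩

open Classical in
/-- The number of executions of order `o` before episode `t`. -/
noncomputable def executions (sel : ℕ → List A) (o : List A) (t : ℕ) : ℕ :=
  ((Finset.range t).filter (fun s => sel s = o)).card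

lemma executions_succ_of_eq {t : ℕ} (h : sel t = o) :
    executions sel o (t + 1) = executions sel o t + 1 := by
  rw [executions, Finset.range_add_one, Finset.filter_insert, if_pos h,
    Finset.card_insert_of_notMem (by simp), executions]

lemma executions_succ_of_ne {t : ℕ} (h : sel t ≠ o) :
    executions sel o (t + 1) = executions sel o t := by
  rw [executions, Finset.range_add_one, Finset.filter_insert, if_neg h, executions]

lemma episodeReward_eq {t : ℕ} (h : sel t = o) :
    episodeReward X sel t = X o (executions sel o t) := by
  subst h
  rfl

lemma IsRun.eventually_recorded_iff (hrun : IsRun q C X sel) (ho : q.IsOrder o) :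
    ∀ᶠ t in atTop, (Recorded X sel t o ↔ sel t = o) :=
  (eventually_recorded o).mono fun t ht => ht.trans (ho.prefix_iff (hrun.isOrder t))

lemma IsRun.count_eq_executions (hrun : IsRun q C X sel) (ho : q.IsOrder o) :
    ∃ c : ℤ, ∀ᶠ t in atTop, ((stats X sel t).count o : ℤ) = executions sel o t + c := by
  obtain ⟨c, hc⟩ := exists_eventually_eq_const
    (f := fun t => ((stats X sel t).count o : ℤ) - executions sel o t) (by
    filter_upwards [hrun.eventually_recorded_iff ho] with t ht
    rw [count_succ]
    by_cases h : sel t = o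
    · rw [executions_succ_of_eq h, if_pos (ht.2 h)]
      push_cast
      ring
    · rw [executions_succ_of_ne h, if_neg (mt ht.1 h), add_zero])
  exact ⟨c, hc.mono fun t ht => by linarith⟩

lemma IsRun.total_eq_executions (hrun : IsRun q C X sel) (ho : q.IsOrder o) :
    ∃ c : ℝ, ∀ᶠ t in atTop, (stats X sel t).total o =
      ∑ k ∈ Finset.range (executions sel o t), X o k + c := by
  obtain ⟨c, hc⟩ := exists_eventually_eq_const (f := fun t => (stats X sel t).total o -
      ∑ k ∈ Finset.range (executions sel o t), X o k) (by
    filter_upwards [hrun.eventually_recorded_iff ho] with t ht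
    rw [total_succ]
    by_cases h : sel t = o
    · rw [executions_succ_of_eq h, if_pos (ht.2 h), Finset.sum_range_succ, episodeReward_eq h]
      ring
    · rw [executions_succ_of_ne h, if_neg (mt ht.1 h), add_zero])
  exact ⟨c, hc.mono fun t ht => by linarith⟩

/-- Executions before the parent of the leaf has a node are not recorded. They change count and
total only by constants, which vanish in the limit. -/
lemma IsRun.mean_tendsto_of_isOrder (hrun : IsRun q C X sel) (ho : q.IsOrder o) {v : ℝ}
    (hv : Tendsto (fun k : ℕ => (∑ i ∈ Finset.range k, X o i) / k) atTop (𝓝 v))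
    (hN : Tendsto (fun t => (stats X sel t).count o) atTop atTop) :
    Tendsto (fun t => (stats X sel t).mean o) atTop (𝓝 v) := by
  obtain ⟨c, hc⟩ := hrun.count_eq_executions ho
  obtain ⟨d, hd⟩ := hrun.total_eq_executions ho
  have hE : Tendsto (executions sel o) atTop atTop := by
    refine tendsto_atTop.2 fun B => ?_
    filter_upwards [hc, hN.eventually_ge_atTop (B + c.toNat)] with t h₁ h₂
    omega
  have hER : Tendsto (fun t => (executions sel o t : ℝ)) atTop atTop :=
    tendsto_natCast_atTop_atTop.comp hE
  have h₁ : Tendsto (fun t => ((∑ i ∈ Finset.range (executions sel o t), X o i) /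
      executions sel o t + d / executions sel o t) / (1 + c / executions sel o t)) atTop (𝓝 v) := by
    have hlim := ((hv.comp hE).add ((tendsto_const_nhds (x := d)).div_atTop hER)).div
      (((tendsto_const_nhds (x := (c : ℝ))).div_atTop hER).const_add 1) (by norm_num)
    rwa [add_zero, add_zero, div_one] at hlim
  refine h₁.congr' ?_
  filter_upwards [hc, hd, hE.eventually_gt_atTop 0] with t hc hd hpos
  have hpos' : (executions sel o t : ℝ) ≠ 0 := by exact_mod_cast hpos.ne'
  have hc' : ((stats X sel t).count o : ℝ) = executions sel o t + c := by exact_mod_cast hc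
  rw [Stats.mean, hc', hd, ← add_div, ← div_self hpos', ← add_div, div_div_div_cancel_right₀ hpos']

/-- The sample means of the rewards of `o` tend to `r o`, for each order `o`. -/
def HasMeans (q : Query A) (X : List A → ℕ → ℝ) (r : List A → ℝ) : Prop :=
  ∀ o, q.IsOrder o →
    Tendsto (fun k : ℕ => (∑ i ∈ Finset.range k, X o i) / k) atTop (𝓝 (r o))

/-! ### Convergence of means and frequencies in the whole tree -/

variable (hq : ∀ a a', Relation.ReflTransGen q.Connects a a') (hC : 0 < C)
  (hrun : IsRun q C X sel) (hX : ∀ o, q.IsOrder o → ∀ k, X o k ∈ Set.Icc (0 : ℝ) 1)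
  (hr : HasMeans q X r)

include hq hC hrun hX hr

/-- Divergence of the count is kept as a premise inside the upward induction, because it propagates
downwards, in `count_tendsto`. -/
lemma mean_tendsto_value_of_count (hp : q.IsValid p) :
    Tendsto (fun t => (stats X sel t).count p) atTop atTop →
      Tendsto (fun t => (stats X sel t).mean p) atTop (𝓝 (q.value r p)) := by
  refine hp.induction_up (P := fun p => Tendsto (fun t => (stats X sel t).count p) atTop atTop →
      Tendsto (fun t => (stats X sel t).mean p) atTop (𝓝 (q.value r p)))
    (fun o ho hN => ?_) fun p hp hx ih hN => ?_
  · rw [ho.value_eq]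
    exact hrun.mean_tendsto_of_isOrder ho (hr o ho) hN
  · have h := hrun.ucbProcess hX hx hN
    obtain ⟨a, ha, hav⟩ := hp.exists_value_append_eq hq hx (r := r)
    exact h.mean_tendsto hC (fun _ _ _ => rfl) (hrun.total_eq_sum hx)
      (fun a ha => ih a (Query.mem_actions.1 ha) (h.tendsto_count hC ha))
      (fun a ha => (hp.append (Query.mem_actions.1 ha)).value_append_le hq)
      (Query.mem_actions.2 ha) hav

lemma count_tendsto (hp : q.IsValid p) :
    Tendsto (fun t => (stats X sel t).count p) atTop atTop := by
  induction p using List.reverseRecOn with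
  | nil =>
    simp only [count_nil]
    exact tendsto_id
  | append_singleton p a ih =>
    have ha := hp p a (List.prefix_refl _)
    exact (hrun.ucbProcess hX ⟨a, ha.1⟩ (ih (hp.of_prefix (List.prefix_append _ _)))).tendsto_count
      hC (Query.mem_actions.2 ha)

lemma mean_tendsto_value (hp : q.IsValid p) :
    Tendsto (fun t => (stats X sel t).mean p) atTop (𝓝 (q.value r p)) :=
  mean_tendsto_value_of_count hq hC hrun hX hr hp (count_tendsto hq hC hrun hX hr hp)

/-- Going down from the root, the frequency becomes negligible at the first attribute where the
value drops, and stays so afterwards. -/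
lemma count_div_tendsto_zero (hp : q.IsValid p) (hlt : q.value r p < q.value r []) :
    Tendsto (fun t : ℕ => ((stats X sel t).count p : ℝ) / t) atTop (𝓝 0) := by
  induction p using List.reverseRecOn with
  | nil => exact (lt_irrefl _ hlt).elim
  | append_singleton p a ih =>
    have ha := hp p a (List.prefix_refl _)
    have hp' := hp.of_prefix (List.prefix_append p [a])
    have hN := count_tendsto hq hC hrun hX hr hp'
    have h := hrun.ucbProcess hX ⟨a, ha.1⟩ hN
    have hratio (b : A) : ∀ᶠ t : ℕ in atTop, ((stats X sel t).count (p ++ [b]) : ℝ) / t =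
        ((stats X sel t).count (p ++ [b]) : ℝ) / (stats X sel t).count p *
          (((stats X sel t).count p : ℝ) / t) := by
      filter_upwards [hN.eventually_gt_atTop 0] with t ht
      have : ((stats X sel t).count p : ℝ) ≠ 0 := by exact_mod_cast ht.ne'
      rw [div_mul_div_cancel₀ this]
    -- If the value drops at `a`, the first factor tends to 0 and the second is at most 1. Otherwise
    -- the value already dropped before, and the second factor tends to 0 while the first is
    -- bounded.
    rcases (hp.value_append_le hq (r := r)).lt_or_eq with hlt' | heq
    · obtain ⟨b, hb, hbv⟩ := hp'.exists_value_append_eq hq ⟨a, ha.1⟩ (r := r)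
      have h₁ := h.count_ratio_tendsto_zero hC (Query.mem_actions.2 ha) (Query.mem_actions.2 hb)
        (hbv ▸ hlt') (mean_tendsto_value hq hC hrun hX hr hp)
        (mean_tendsto_value hq hC hrun hX hr (hp'.append hb))
      refine squeeze_zero_norm' ?_ h₁
      filter_upwards [hratio a] with t ht
      rw [Real.norm_of_nonneg (by positivity), ht]
      refine mul_le_of_le_one_right (by positivity) (div_le_one_of_le₀ ?_ (Nat.cast_nonneg _))
      exact_mod_cast count_le_episodes p t
    · obtain ⟨K, hK⟩ := h.exists_count_le
      have h₁ := (ih hp' (heq ▸ hlt)).const_mul K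
      rw [mul_zero] at h₁
      refine squeeze_zero_norm' ?_ h₁
      filter_upwards [hratio a, hK a (Query.mem_actions.2 ha)] with t ht ht'
      rw [Real.norm_of_nonneg (by positivity), ht]
      exact mul_le_mul_of_nonneg_right ht' (by positivity)

lemma executions_div_tendsto_zero (ho : q.IsOrder o) (hlt : r o < q.value r []) :
    Tendsto (fun t : ℕ => (executions sel o t : ℝ) / t) atTop (𝓝 0) := by
  obtain ⟨c, hc⟩ := hrun.count_eq_executions ho
  have h₁ := count_div_tendsto_zero hq hC hrun hX hr ho.isValid (ho.value_eq.trans_lt hlt)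
  have h₂ := h₁.sub ((tendsto_const_nhds (x := (c : ℝ))).div_atTop
    (tendsto_natCast_atTop_atTop (R := ℝ)))
  rw [sub_zero] at h₂
  refine h₂.congr' (hc.mono fun t ht => ?_)
  have hc' : ((stats X sel t).count o : ℝ) = executions sel o t + c := by exact_mod_cast ht
  rw [hc', ← sub_div, add_sub_cancel_right]

open Classical in
theorem tendsto_fraction_optimal :
    Tendsto (fun T : ℕ => (((Finset.range T).filter (fun t =>
        ∀ o', q.IsOrder o' → r o' ≤ r (sel t))).card : ℝ) / T) atTop (𝓝 1) := by
  have hfin : {o | q.IsOrder o ∧ r o < q.value r []}.Finite :=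
    q.finite_isValid.subset fun _ ho => ho.1.isValid
  have hlim : Tendsto (fun T : ℕ => 1 - ∑ o ∈ hfin.toFinset, (executions sel o T : ℝ) / T)
      atTop (𝓝 1) := by
    have := tendsto_finsetSum hfin.toFinset fun o ho => executions_div_tendsto_zero hq hC hrun hX hr
      (hfin.mem_toFinset.1 ho).1 (hfin.mem_toFinset.1 ho).2
    simpa using this.const_sub 1
  refine tendsto_of_tendsto_of_tendsto_of_le_of_le' hlim tendsto_const_nhds ?_ ?_
  · filter_upwards [eventually_gt_atTop 0] with T hT
    have hT' : (0 : ℝ) < T := by exact_mod_cast hT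
    rw [← Finset.sum_div, le_div_iff₀ hT', sub_mul, one_mul, div_mul_cancel₀ _ hT'.ne',
      sub_le_iff_le_add]
    have hcard : T ≤ ((Finset.range T).filter (fun t =>
        ∀ o', q.IsOrder o' → r o' ≤ r (sel t))).card +
          ∑ o ∈ hfin.toFinset, executions sel o T := by
      conv_lhs => rw [← Finset.card_range T,
        ← Finset.card_filter_add_card_filter_not (s := Finset.range T) (fun t =>
          ∀ o', q.IsOrder o' → r o' ≤ r (sel t))]
      refine Nat.add_le_add_left ((Finset.card_le_card ?_).trans Finset.card_biUnion_le) _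
      intro t ht
      rw [Finset.mem_filter, forall_le_iff_value_le hq, not_le] at ht
      rw [Finset.mem_biUnion]
      exact ⟨sel t, hfin.mem_toFinset.2 ⟨hrun.isOrder t, ht.2⟩, Finset.mem_filter.2 ⟨ht.1, rfl⟩⟩
    exact_mod_cast hcard
  · refine Eventually.of_forall fun T => div_le_one_of_le₀ ?_ (Nat.cast_nonneg _)
    exact_mod_cast (Finset.card_filter_le _ _).trans (Finset.card_range T).le

theorem eventually_greedy_optimal :
    ∀ᶠ T in atTop, ∀ o, IsGreedy q (stats X sel T) o → ∀ o', q.IsOrder o' → r o' ≤ r o := by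
  have hev : ∀ᶠ T in atTop, ∀ p ∈ {p | q.IsValid p}, ∀ a a', q.Action p a → q.Action p a' →
      q.value r (p ++ [a]) < q.value r (p ++ [a']) →
        (stats X sel T).mean (p ++ [a]) < (stats X sel T).mean (p ++ [a']) := by
    refine (Filter.eventually_all_finite q.finite_isValid).2 fun p hp =>
      eventually_all.2 fun a => eventually_all.2 fun a' => ?_
    by_cases h : q.Action p a ∧ q.Action p a' ∧ q.value r (p ++ [a]) < q.value r (p ++ [a'])
    · have hp : q.IsValid p := hp
      filter_upwards [(mean_tendsto_value hq hC hrun hX hr (hp.append h.1)).eventually_lt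
        (mean_tendsto_value hq hC hrun hX hr (hp.append h.2.1)) h.2.2] with T hT _ _ _ using hT
    · exact Eventually.of_forall fun T h₁ h₂ h₃ => (h ⟨h₁, h₂, h₃⟩).elim
  filter_upwards [hev] with T hT o ho
  -- Some successor keeps the value, and a successor of maximal mean cannot have a smaller one, so
  -- no greedy step loses value.
  have hval : ∀ p, p <+: o → q.value r [] ≤ q.value r p := by
    intro p
    induction p using List.reverseRecOn with
    | nil => exact fun _ => le_rfl
    | append_singleton p a ih =>
      intro hpa
      have ha := ho.1.2 p a hpa
      have hpo := (List.prefix_append p [a]).trans hpa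
      have hp := ho.1.isValid.of_prefix hpo
      obtain ⟨b, hb, hbv⟩ := hp.exists_value_append_eq hq ⟨a, ha.1⟩ (r := r)
      refine (ih hpo).trans (hbv ▸ not_lt.1 fun hlt => ?_)
      exact (hT p hp a b ha hb hlt).not_ge (ho.2 p a hpa b hb)
  rw [forall_le_iff_value_le hq, ← ho.1.value_eq (r := r)]
  exact hval o (List.prefix_refl _)

end Convergence

/-! ### From average rewards and the strong law to the theorem -/

lemma isOptimal_iff {A : Type*} [Fintype A] [DecidableEq A] [Nonempty A] {q : Query A} {n b : ℕ}
    (hn : 1 ≤ n) (hb : 1 ≤ b) {o : List A} (ho : q.IsOrder o) :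
    IsOptimal q n b o ↔
      ∀ o', q.IsOrder o' → averageReward q n b o' ≤ averageReward q n b o := by
  rw [IsOptimal, and_iff_right ho]
  exact forall₂_congr fun o' ho' =>
    expectedSteps_le_iff hn hb ho.isValid.nodup ho'.isValid.nodup

lemma ae_tendsto_sample_mean {Ω : Type*} [MeasurableSpace Ω] {μ : Measure Ω}
    [IsProbabilityMeasure μ] {Y : ℕ → Ω → ℝ} (hindep : iIndepFun Y μ)
    (hident : ∀ k, IdentDistrib (Y k) (Y 0) μ μ)
    (hrange : ∀ k, ∀ᵐ ω ∂μ, Y k ω ∈ Set.Icc (0 : ℝ) 1) :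
    ∀ᵐ ω ∂μ, Tendsto (fun k : ℕ => (∑ i ∈ Finset.range k, Y i ω) / k) atTop
      (𝓝 (∫ ω, Y 0 ω ∂μ)) := by
  refine strong_law_ae_real Y ?_ (fun i j hij => hindep.indepFun hij) hident
  refine Integrable.of_bound (hident 0).aemeasurable_fst.aestronglyMeasurable 1 ?_
  filter_upwards [hrange 0] with ω hω
  rw [Real.norm_of_nonneg hω.1]
  exact hω.2

end Adopt

open Classical in
theorem mainTheorem2 {A : Type*} [Fintype A] [DecidableEq A] [Nonempty A]
    (q : Adopt.Query A) (hq : ∀ a a', Relation.ReflTransGen q.Connects a a')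
    (n b : ℕ) (hn : 1 ≤ n) (hb : 1 ≤ b) (C : ℝ) (hC : 0 < C)
    {Ω : Type*} [MeasurableSpace Ω] (μ : Measure Ω) [IsProbabilityMeasure μ]
    (X : List A → ℕ → Ω → ℝ)
    (hX_indep : ∀ o, q.IsOrder o → iIndepFun (X o) μ)
    (hX_ident : ∀ o, q.IsOrder o → ∀ k, IdentDistrib (X o k) (X o 0) μ μ)
    (hX_range : ∀ o, q.IsOrder o → ∀ k, ∀ᵐ ω ∂μ, X o k ω ∈ Set.Icc (0 : ℝ) 1)
    (hX_mean : ∀ o, q.IsOrder o → ∫ ω, X o 0 ω ∂μ = Adopt.averageReward q n b o)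
    (sel : ℕ → Ω → List A)
    (hsel : ∀ᵐ ω ∂μ, Adopt.IsRun q C (fun o k => X o k ω) (fun t => sel t ω)) :
    ∀ᵐ ω ∂μ,
      Tendsto (fun T : ℕ =>
          (((Finset.range T).filter (fun t => Adopt.IsOptimal q n b (sel t ω))).card : ℝ) / T)
        atTop (𝓝 1) ∧
      ∀ᶠ T : ℕ in atTop, ∀ o : List A,
        Adopt.IsGreedy q (Adopt.stats (fun o k => X o k ω) (fun t => sel t ω) T) o →
          Adopt.IsOptimal q n b o := by
  have hrange : ∀ᵐ ω ∂μ, ∀ o, q.IsOrder o → ∀ k, X o k ω ∈ Set.Icc (0 : ℝ) 1 := by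
    simp only [ae_all_iff]
    exact hX_range
  have hmeans : ∀ᵐ ω ∂μ,
      Adopt.HasMeans q (fun o k => X o k ω) (Adopt.averageReward q n b) := by
    simp only [Adopt.HasMeans, ae_all_iff]
    intro o ho
    rw [← hX_mean o ho]
    exact Adopt.ae_tendsto_sample_mean (hX_indep o ho) (hX_ident o ho) (hX_range o ho)
  -- The outcome is fixed from here on; what remains is deterministic.
  filter_upwards [hrange, hmeans, hsel] with ω h₁ h₂ h₃
  refine ⟨?_, ?_⟩
  · simp only [Adopt.isOptimal_iff hn hb (h₃.isOrder _)]
    exact Adopt.tendsto_fraction_optimal hq hC h₃ h₁ h₂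
  · filter_upwards [Adopt.eventually_greedy_optimal hq hC h₃ h₁ h₂] with T hT o ho
    exact (Adopt.isOptimal_iff hn hb ho.1).2 (hT o ho)
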